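/- Let $h(t)=e^{2t}$ and $K(x,x')=h(\langle x,x'\rangle/d)=e^{2\langle x,x'\rangle/d}$ on $\mathbb{R}^d$. For a symmetric positive definite $\Sigma_d\in\mathbb{R}^{d\times d}$ put $$\alpha=h(0)+h''(0)\frac{\mathrm{Tr}(\Sigma_d^2)}{d^2},\quad \beta=h'(0),\quad \gamma=h\Big(\frac{\mathrm{Tr}(\Sigma_d)}{d}\Big)-h(0)-h'(0)\frac{\mathrm{Tr}(\Sigma_d)}{d},\quad \mathbf r=\frac{\gamma}{\beta}.$$ Let $X\in\mathbb{R}^{n\times d}$ have rows $x_1,\dots,x_n$, let $K(X,X)=[K(x_i,x_j)]_{ij}$, and let $\lambda_1\ge\lambda_2\ge\dots$ denote the ordered eigenvalues of a symmetric matrix. For a noise level $\sigma>0$, a function $f_*$ in the reproducing kernel Hilbert space $\mathcal H$ of $K$ and $M\ge 0$, the variance and bias terms of the data-dependent risk bound are $$\mathbf V=\frac{8\sigma^2\|\Sigma_d\|_{\mathrm{op}}}{d}\sum_{j=1}^n\frac{\lambda_j\big(\frac{XX^*}{d}+\frac{\alpha}{\beta}11^*\big)}{\big[\mathbf r+\lambda_j\big(\frac{XX^*}{d}+\frac{\alpha}{\beta}11^*\big)\big]^2},\qquad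 \mathbf B_M=\|f_*\|_{\mathcal H}^2\inf_{0\le k\le n}\Big\{\frac1n\sum_{j>k}\lambda_j(K(X,X))+2M\sqrt{\frac kn}\Big\},$$ and their reduced forms in the regime $n>d$ are $$\mathbf V'=\frac1d\sum_{j=1}^n\frac{\lambda_j(XX^*/d)}{[\mathbf r+\lambda_j(XX^*/d)]^2},\qquad \mathbf B'=\mathbf r+\frac1d\sum_{j=1}^d\lambda_j\Big(\frac{XX^*}{n}\Big).$$ There is an absolute constant $d_0$ and, for every $\rho\in(0,1)$, a constant $C=C(\rho)>0$ such that the following holds. For all $d\ge d_0$ and $n$ with $d\le\rho n$, every positive definite $\Sigma_d$ with $\|\Sigma_d\|_{\mathrm{op}}\le1$, i.i.d. $x_1,\dots,x_n\sim N(0,\Sigma_d)$, and every $\sigma>0$ and $f_*\in\mathcal H$, with probability at least $1-C/n$ all of the following hold simultaneously: $$\mathbf V\le C\sigma^2\,\frac{\mathrm{Tr}(\Sigma_d^{-1})}{n},\qquad \mathbf B_M\le\|f_*\|_{\mathcal H}^2\Big(C\Big(\mathbf r+\frac{\mathrm{Tr}(\Sigma_d)}{d}\Big)+\frac{2M}{\sqrt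 n}\Big)\ \text{ for all } M\ge0,$$ $$\mathbf V'\le C\,\frac{\mathrm{Tr}(\Sigma_d^{-1})}{n},\qquad \mathbf B'\le C\Big(\mathbf r+\frac{\mathrm{Tr}(\Sigma_d)}{d}\Big).$$ -/

import Mathlib

open MeasureTheory ProbabilityTheory

noncomputable section

namespace Ridgeless

/-- The operator norm of a real square matrix, as an operator on Euclidean space. -/
def opNorm {d : ℕ} (S : Matrix (Fin d) (Fin d) ℝ) : ℝ :=
  ‖Matrix.toEuclideanCLM (n := Fin d) (𝕜 := ℝ) S‖

/-- The inner-product kernel `K(x, x') = h(⟨x, x'⟩ / d)` on `ℝ^d`. -/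
def innerKernel (h : ℝ → ℝ) {d : ℕ} (x x' : EuclideanSpace ℝ (Fin d)) : ℝ :=
  h (inner ℝ x x' / d)

/-- The kernel matrix `K(X, X)`. -/
def kernelMatrix (h : ℝ → ℝ) {d n : ℕ} (X : Fin n → EuclideanSpace ℝ (Fin d)) :
    Matrix (Fin n) (Fin n) ℝ :=
  Matrix.of fun i j => innerKernel h (X i) (X j)

/-- The matrix `X X^*` for the design matrix `X` with rows `x_1, …, x_n`. -/
def designGram {d n : ℕ} (X : Fin n → EuclideanSpace ℝ (Fin d)) :
    Matrix (Fin n) (Fin n) ℝ :=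
  Matrix.of fun i j => inner ℝ (X i) (X j)

/-- The matrix `a X X^* + b 1 1^*`. -/
def shiftedGram (a b : ℝ) {d n : ℕ} (X : Fin n → EuclideanSpace ℝ (Fin d)) :
    Matrix (Fin n) (Fin n) ℝ :=
  a • designGram X + b • Matrix.of fun _ _ => 1

theorem kernelMatrix_isHermitian (h : ℝ → ℝ) {d n : ℕ}
    (X : Fin n → EuclideanSpace ℝ (Fin d)) : (kernelMatrix h X).IsHermitian := by
  ext i j
  simp [kernelMatrix, innerKernel, real_inner_comm]

theorem shiftedGram_isHermitian (a b : ℝ) {d n : ℕ}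
    (X : Fin n → EuclideanSpace ℝ (Fin d)) : (shiftedGram a b X).IsHermitian := by
  ext i j
  simp [shiftedGram, designGram, real_inner_comm]

/-- The eigenvalues, with multiplicity and in nonincreasing order, of a real symmetric matrix:
index `j : Fin n` carries the `(j+1)`-st largest eigenvalue. -/
def eig {n : ℕ} {A : Matrix (Fin n) (Fin n) ℝ} (hA : A.IsHermitian) (j : Fin n) : ℝ :=
  hA.eigenvalues₀ (Fin.cast (Fintype.card_fin n).symm j)

/-- `α = h(0) + h''(0) Tr(Σ²) / d²`. -/
def coefAlpha (h : ℝ → ℝ) {d : ℕ} (S : Matrix (Fin d) (Fin d) ℝ) : ℝ :=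
  h 0 + iteratedDeriv 2 h 0 * ((S * S).trace / (d : ℝ) ^ 2)

/-- `β = h'(0)`. -/
def coefBeta (h : ℝ → ℝ) : ℝ := deriv h 0

/-- `γ = h(Tr(Σ)/d) - h(0) - h'(0) Tr(Σ)/d`. -/
def coefGamma (h : ℝ → ℝ) {d : ℕ} (S : Matrix (Fin d) (Fin d) ℝ) : ℝ :=
  h (S.trace / d) - h 0 - deriv h 0 * (S.trace / d)

/-- The implicit regularization `r = γ / β`. -/
def implicitReg (h : ℝ → ℝ) {d : ℕ} (S : Matrix (Fin d) (Fin d) ℝ) : ℝ :=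
  coefGamma h S / coefBeta h

/-- The variance term of the data-dependent bound:
`(8 σ² ‖Σ‖ / d) ∑_j λ_j(XX^*/d + (α/β) 11^*) / [γ/β + λ_j(XX^*/d + (α/β) 11^*)]²`. -/
def varianceBound (h : ℝ → ℝ) (σ : ℝ) {d n : ℕ} (S : Matrix (Fin d) (Fin d) ℝ)
    (X : Fin n → EuclideanSpace ℝ (Fin d)) : ℝ :=
  8 * σ ^ 2 * opNorm S / d *
    ∑ j : Fin n, eig (shiftedGram_isHermitian (1 / (d : ℝ)) (coefAlpha h S / coefBeta h) X) j /
      (implicitReg h S +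
        eig (shiftedGram_isHermitian (1 / (d : ℝ)) (coefAlpha h S / coefBeta h) X) j) ^ 2

/-- The bias term of the data-dependent bound, for a target of RKHS norm `R`:
`R² inf_{0 ≤ k ≤ n} { (1/n) ∑_{j > k} λ_j(K(X, X)) + 2 M √(k/n) }`.
With zero-based indices, `j > k` reads `k ≤ j`. -/
def biasBound (h : ℝ → ℝ) (R M : ℝ) {d n : ℕ} (X : Fin n → EuclideanSpace ℝ (Fin d)) : ℝ :=
  R ^ 2 * ⨅ k : Fin (n + 1),
    (1 / (n : ℝ) * ∑ j ∈ Finset.univ.filter (fun j : Fin n => (k : ℕ) ≤ (j : ℕ)),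
        eig (kernelMatrix_isHermitian h X) j +
      2 * M * √((k : ℝ) / n))

/-- The reduced variance bound, without the term along `11^*` and without constant factors:
`(1/d) ∑_j λ_j(XX^*/d) / [r + λ_j(XX^*/d)]²`. -/
def reducedVariance (h : ℝ → ℝ) {d n : ℕ} (S : Matrix (Fin d) (Fin d) ℝ)
    (X : Fin n → EuclideanSpace ℝ (Fin d)) : ℝ :=
  1 / (d : ℝ) * ∑ j : Fin n, eig (shiftedGram_isHermitian (1 / (d : ℝ)) 0 X) j /
    (implicitReg h S + eig (shiftedGram_isHermitian (1 / (d : ℝ)) 0 X) j) ^ 2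

/-- The reduced bias bound `r + (1/d) ∑_{j=1}^d λ_j(XX^*/n)` for `n > d`. -/
def reducedBias (h : ℝ → ℝ) {d n : ℕ} (S : Matrix (Fin d) (Fin d) ℝ)
    (X : Fin n → EuclideanSpace ℝ (Fin d)) : ℝ :=
  implicitReg h S + 1 / (d : ℝ) *
    ∑ j ∈ Finset.univ.filter (fun j : Fin n => (j : ℕ) < d),
      eig (shiftedGram_isHermitian (1 / (n : ℝ)) 0 X) j

/-- The non-linearity `h(t) = exp(2t)`, so that `K(x, x') = exp(2⟨x, x'⟩/d)`. -/
def expNonlin (t : ℝ) : ℝ := Real.exp (2 * t)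

end Ridgeless

end

/-! Variance. In the eigenbasis of Σ, with eigenvalues s_k, write XX^*/d = ∑ (s_k/d) z_k z_k^*. The
whitened columns z_k ∈ ℝⁿ are independent standard Gaussian vectors
(`pi_multivariateGaussian_map_whitenedCol`). For a matrix ∑ w_k w_k^* with a family b_k dual to the
w_k, the sum of λ/(r+λ)² is at most ∑ ‖b_k‖² (`sum_eig_div_le`), so nothing beyond r ≥ 0 is needed.
A dual vector of z_k has norm 1/dist(z_k, span of the others), and that span has codimension at
least (1-ρ)n. A Chernoff bound and a union bound therefore make every distance at least √(cn), with
c = (1-ρ)/4, outside probability O(1/n). Rescaling the dual vectors by (s_k/d)^(-1/2) produces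
Tr(Σ⁻¹)/n.

The summand along 11^* is one more generator. The vector 1 is put into every span, so that the b_k
are also orthogonal to it, and a dual vector of 1 is built from the b_k (`exists_dual_ones`). Its
cost is absorbed by d ≤ Tr(Σ⁻¹), which holds since ‖Σ‖ ≤ 1.

Bias. Taking k = 1 discards the top kernel eigenvalue, which is at least n because exp(x) ≥ 1 + x.
What remains is the average of exp(2‖x_i‖²/d) - 1, and the reduced bias is controlled by the same
average. Chebyshev's inequality bounds it by O(Tr(Σ)/d), since the second moment is O((Tr(Σ)/d)²).

The exceptional events involve X alone, so σ, f_* and M are arbitrary on their complement. -/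

namespace Ridgeless

/-! ### Deterministic eigenvalue bounds -/

section Eigenvalues

theorem sum_eig {n : ℕ} {A : Matrix (Fin n) (Fin n) ℝ} (hA : A.IsHermitian) (φ : ℝ → ℝ) :
    ∑ j, φ (eig hA j) = ∑ i, φ (hA.eigenvalues i) := by
  simp only [eig, Matrix.IsHermitian.eigenvalues]
  rw [← Equiv.sum_comp (finCongr (Fintype.card_fin n)),
    ← Equiv.sum_comp (Fintype.equivOfCardEq (Fintype.card_fin (Fintype.card (Fin n))))]
  simp

/-- Evaluate ⟨b, A e_j⟩ twice: through the eigenvector equation and through A = ∑ w_k w_kᵀ. -/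
theorem eigenvalues_mul_inner {n : ℕ} {A : Matrix (Fin n) (Fin n) ℝ} (hA : A.IsHermitian)
    {ι : Type*} [Fintype ι] (w : ι → EuclideanSpace ℝ (Fin n))
    (hw : ∀ i j, A i j = ∑ k, w k i * w k j) (b : EuclideanSpace ℝ (Fin n)) (j : Fin n) :
    hA.eigenvalues j * inner ℝ b (hA.eigenvectorBasis j) =
      ∑ k, inner ℝ b (w k) * inner ℝ (w k) (hA.eigenvectorBasis j) := by
  have h := hA.mulVec_eigenvectorBasis j
  have h' : ∀ i, ∑ l, A i l * hA.eigenvectorBasis j l =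
      hA.eigenvalues j * hA.eigenvectorBasis j i := fun i => by
    simpa [Matrix.mulVec, dotProduct] using congrFun h i
  simp only [PiLp.inner_apply, RCLike.inner_apply, conj_trivial, Finset.mul_sum, Finset.sum_mul]
  simp_rw [← mul_assoc, ← h', Finset.sum_mul, hw, Finset.sum_mul]
  rw [Finset.sum_congr rfl fun i _ => Finset.sum_comm, Finset.sum_comm]
  refine Finset.sum_congr rfl fun k _ => ?_
  rw [Finset.sum_comm]
  refine Finset.sum_congr rfl fun l _ => Finset.sum_congr rfl fun i _ => ?_
  ring

/-- For a Gram-type matrix `A = ∑ w_k w_kᵀ` and a family `b` dual to `w`, the filtered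
reciprocals of the eigenvalues are bounded by the squared norms of the dual family. -/
theorem sum_eig_div_le {n : ℕ} {A : Matrix (Fin n) (Fin n) ℝ} (hA : A.IsHermitian)
    {ι : Type*} [Fintype ι] [DecidableEq ι] (w b : ι → EuclideanSpace ℝ (Fin n))
    (hw : ∀ i j, A i j = ∑ k, w k i * w k j)
    (hb : ∀ k l, inner ℝ (b k) (w l) = if k = l then 1 else 0) {r : ℝ} (hr : 0 ≤ r) :
    ∑ j, eig hA j / (r + eig hA j) ^ 2 ≤ ∑ k, ‖b k‖ ^ 2 := by
  rw [sum_eig hA fun x => x / (r + x) ^ 2]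
  calc _ ≤ ∑ j, ∑ k, (inner ℝ (b k) (hA.eigenvectorBasis j)) ^ 2 := ?_
    _ = ∑ k, ‖b k‖ ^ 2 := by
      rw [Finset.sum_comm]
      exact Finset.sum_congr rfl fun k _ => hA.eigenvectorBasis.sum_sq_inner_left _
  refine Finset.sum_le_sum fun j _ => ?_
  have h1 : ∀ k, hA.eigenvalues j * inner ℝ (b k) (hA.eigenvectorBasis j) =
      inner ℝ (w k) (hA.eigenvectorBasis j) := fun k => by
    rw [eigenvalues_mul_inner hA w hw]; simp [hb]
  have h2 := eigenvalues_mul_inner hA w hw (hA.eigenvectorBasis j) j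
  have h3 : inner ℝ (hA.eigenvectorBasis j) (hA.eigenvectorBasis j) = (1 : ℝ) := by simp
  rw [h3, mul_one] at h2
  simp_rw [real_inner_comm _ (hA.eigenvectorBasis j), ← h1] at h2
  set x := hA.eigenvalues j
  -- Duality turns λ_j = ∑ ⟨w_k, e_j⟩² into this identity, so either λ_j = 0 or ∑ ⟨b_k, e_j⟩² =
  -- 1/λ_j.
  have h4 : x = x ^ 2 * ∑ k, (inner ℝ (b k) (hA.eigenvectorBasis j)) ^ 2 := by
    rw [Finset.mul_sum]
    exact h2.trans (Finset.sum_congr rfl fun k _ => by rw [real_inner_comm]; ring)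
  have h5 : 0 ≤ ∑ k, (inner ℝ (b k) (hA.eigenvectorBasis j)) ^ 2 :=
    Finset.sum_nonneg fun k _ => sq_nonneg _
  have hx : 0 ≤ x := by rw [h4]; positivity
  rcases hx.eq_or_lt with h0 | hx
  · rw [← h0]; simpa using h5
  · rw [div_le_iff₀ (by positivity)]
    calc x = x ^ 2 * ∑ k, (inner ℝ (b k) (hA.eigenvectorBasis j)) ^ 2 := h4
      _ ≤ (r + x) ^ 2 * _ := by gcongr; linarith
      _ = _ := mul_comm _ _

theorem sum_eig_eq_trace {n : ℕ} {A : Matrix (Fin n) (Fin n) ℝ} (hA : A.IsHermitian) :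
    ∑ j, eig hA j = A.trace := by
  rw [sum_eig hA fun x => x, hA.trace_eq_sum_eigenvalues]; simp

/-- The left side is the quadratic form of A at the all-ones vector, whose squared norm is n. -/
theorem sum_entries_le_eig_zero {n : ℕ} {A : Matrix (Fin n) (Fin n) ℝ} (hA : A.IsHermitian)
    (hn : 0 < n) : ∑ i, ∑ j, A i j ≤ n * eig hA ⟨0, hn⟩ := by
  set e : EuclideanSpace ℝ (Fin n) := WithLp.toLp 2 fun _ => 1
  have hle : ∀ i, hA.eigenvalues i ≤ eig hA ⟨0, hn⟩ := fun i =>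
    hA.eigenvalues₀_antitone (Fin.mk_le_of_le_val (Nat.zero_le _))
  have h1 : ∑ j, (inner ℝ (hA.eigenvectorBasis j) e) ^ 2 = (n : ℝ) := by
    rw [hA.eigenvectorBasis.sum_sq_inner_right, EuclideanSpace.norm_sq_eq]; simp [e]
  have h2 : ∑ i, ∑ j, A i j =
      ∑ j, hA.eigenvalues j * (inner ℝ (hA.eigenvectorBasis j) e) ^ 2 := by
    have hsp : ∀ i, ∑ l, A i l = ∑ j, (hA.eigenvalues j * inner ℝ (hA.eigenvectorBasis j) e) *
        hA.eigenvectorBasis j i := fun i => by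
      have he : ∀ l, (1 : ℝ) = ∑ j, inner ℝ (hA.eigenvectorBasis j) e *
          hA.eigenvectorBasis j l := fun l => by
        have := congrArg (fun v : EuclideanSpace ℝ (Fin n) => v l)
          (hA.eigenvectorBasis.sum_repr' e)
        simpa [e] using this.symm
      have h' : ∀ j, ∑ l, A i l * hA.eigenvectorBasis j l =
          hA.eigenvalues j * hA.eigenvectorBasis j i := fun j => by
        simpa [Matrix.mulVec, dotProduct] using congrFun (hA.mulVec_eigenvectorBasis j) i
      calc ∑ l, A i l = ∑ l, A i l * 1 := by simp
        _ = ∑ l, ∑ j, A i l * (inner ℝ (hA.eigenvectorBasis j) e *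
              hA.eigenvectorBasis j l) := by
            refine Finset.sum_congr rfl fun l _ => ?_
            rw [← Finset.mul_sum, ← he l]
        _ = ∑ j, inner ℝ (hA.eigenvectorBasis j) e * ∑ l, A i l * hA.eigenvectorBasis j l := by
            rw [Finset.sum_comm]
            refine Finset.sum_congr rfl fun j _ => ?_
            rw [Finset.mul_sum]
            exact Finset.sum_congr rfl fun l _ => by ring
        _ = _ := Finset.sum_congr rfl fun j _ => by rw [h']; ring
    simp_rw [hsp]
    rw [Finset.sum_comm]
    refine Finset.sum_congr rfl fun j _ => ?_
    rw [← Finset.mul_sum]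
    have : inner ℝ (hA.eigenvectorBasis j) e = ∑ i, hA.eigenvectorBasis j i := by
      simp [PiLp.inner_apply, e]
    rw [this]; ring
  rw [h2, ← h1, Finset.sum_mul]
  exact Finset.sum_le_sum fun j _ => by
    rw [mul_comm]; exact mul_le_mul_of_nonneg_left (hle j) (sq_nonneg _)

theorem eig_nonneg {n : ℕ} {A : Matrix (Fin n) (Fin n) ℝ} (hA : A.PosSemidef) (j : Fin n) :
    0 ≤ eig hA.1 j := by
  have h : eig hA.1 j = hA.1.eigenvalues
      (Fintype.equivOfCardEq (Fintype.card_fin _) (Fin.cast (Fintype.card_fin n).symm j)) := by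
    simp [eig, Matrix.IsHermitian.eigenvalues]
  rw [h]; exact hA.eigenvalues_nonneg _

/-- The bias bound at the level `k = 1`. -/
theorem biasBound_le {d n : ℕ} (hn : 0 < n) (X : Fin n → EuclideanSpace ℝ (Fin d)) (R M : ℝ) :
    biasBound expNonlin R M X ≤
      R ^ 2 * (1 / (n : ℝ) * ∑ i, (Real.exp (2 * (‖X i‖ ^ 2 / d)) - 1) + 2 * M / √n) := by
  unfold biasBound
  refine mul_le_mul_of_nonneg_left ?_ (sq_nonneg R)
  refine (ciInf_le (Set.finite_range _).bddBelow (⟨1, by omega⟩ : Fin (n + 1))).trans ?_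
  have hA := kernelMatrix_isHermitian expNonlin X
  -- By exp(t) ≥ 1 + t the entries of K sum to at least n² + (2/d)‖∑ x_i‖² ≥ n².
  have h0 : (n : ℝ) ≤ eig hA ⟨0, hn⟩ := by
    have h1 := sum_entries_le_eig_zero hA hn
    have h2 : (n : ℝ) * n ≤ ∑ i, ∑ j, kernelMatrix expNonlin X i j := by
      have : ∑ i : Fin n, ∑ j : Fin n, (1 + 2 / d * inner ℝ (X i) (X j)) ≤
          ∑ i, ∑ j, kernelMatrix expNonlin X i j := by
        refine Finset.sum_le_sum fun i _ => Finset.sum_le_sum fun j _ => ?_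
        simp only [kernelMatrix, innerKernel, expNonlin, Matrix.of_apply]
        refine le_trans (le_of_eq ?_) (Real.add_one_le_exp _)
        ring
      refine le_trans ?_ this
      simp_rw [Finset.sum_add_distrib, ← Finset.mul_sum, ← inner_sum, ← sum_inner]
      simp only [Finset.sum_const, Finset.card_univ, Fintype.card_fin, nsmul_eq_mul, mul_one]
      have : 0 ≤ inner ℝ (∑ i, X i) (∑ i, X i) := real_inner_self_nonneg
      have : 0 ≤ 2 / (d : ℝ) * inner ℝ (∑ i, X i) (∑ i, X i) := by positivity
      linarith
    have hn' : (0 : ℝ) < n := by exact_mod_cast hn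
    exact le_of_mul_le_mul_left (h2.trans h1) hn'
  have h3 : ∑ j ∈ Finset.univ.filter (fun j : Fin n => 1 ≤ (j : ℕ)), eig hA j =
      (kernelMatrix expNonlin X).trace - eig hA ⟨0, hn⟩ := by
    rw [← sum_eig_eq_trace hA, ← Finset.sum_filter_add_sum_filter_not Finset.univ
      (fun j : Fin n => 1 ≤ (j : ℕ)), eq_sub_iff_add_eq, add_right_inj]
    symm
    apply Finset.sum_eq_single_of_mem
    · simp
    · intro b hb hb'
      simp only [Finset.mem_filter, Finset.mem_univ, true_and, not_le, Nat.lt_one_iff] at hb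
      exact absurd (Fin.ext hb) hb'
  have h4 : (kernelMatrix expNonlin X).trace = ∑ i, Real.exp (2 * (‖X i‖ ^ 2 / d)) := by
    simp [Matrix.trace, kernelMatrix, innerKernel, expNonlin]
  simp only [h3, h4]
  refine add_le_add ?_ ?_
  · refine mul_le_mul_of_nonneg_left ?_ (by positivity)
    simp only [Finset.sum_sub_distrib, Finset.sum_const, Finset.card_univ, Fintype.card_fin,
      nsmul_eq_mul, mul_one]
    linarith
  · simp [div_eq_mul_inv]

/-- Since t ≤ exp(2t) - 1 for t ≥ 0, the average that controls the bias bound serves here too. -/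
theorem reducedBias_le {d n : ℕ} (S : Matrix (Fin d) (Fin d) ℝ)
    (X : Fin n → EuclideanSpace ℝ (Fin d)) :
    reducedBias expNonlin S X ≤ implicitReg expNonlin S +
      1 / (n : ℝ) * ∑ i, (Real.exp (2 * (‖X i‖ ^ 2 / d)) - 1) := by
  unfold reducedBias
  refine add_le_add le_rfl ?_
  have hP : (shiftedGram (1 / (n : ℝ)) 0 X).PosSemidef := by
    have : shiftedGram (1 / (n : ℝ)) 0 X = (1 / (n : ℝ)) • Matrix.gram ℝ X := by
      ext i j; simp [shiftedGram, designGram, Matrix.gram]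
    rw [this]
    exact (Matrix.posSemidef_gram ℝ X).smul (by positivity)
  have h1 : ∑ j ∈ Finset.univ.filter (fun j : Fin n => (j : ℕ) < d),
      eig (shiftedGram_isHermitian (1 / (n : ℝ)) 0 X) j ≤ 1 / (n : ℝ) * ∑ i, ‖X i‖ ^ 2 := by
    refine (Finset.sum_le_sum_of_subset_of_nonneg (Finset.subset_univ _)
      fun j _ _ => eig_nonneg hP j).trans ?_
    rw [sum_eig_eq_trace]
    simp [Matrix.trace, shiftedGram, designGram, Finset.mul_sum]
  refine (mul_le_mul_of_nonneg_left h1 (by positivity)).trans ?_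
  have h2 : 1 / (d : ℝ) * (1 / (n : ℝ) * ∑ i, ‖X i‖ ^ 2) =
      1 / (n : ℝ) * ∑ i, ‖X i‖ ^ 2 / d := by
    rw [← Finset.sum_div]; ring
  rw [h2]
  refine mul_le_mul_of_nonneg_left (Finset.sum_le_sum fun i _ => ?_) (by positivity)
  have := Real.add_one_le_exp (2 * (‖X i‖ ^ 2 / d))
  have : 0 ≤ ‖X i‖ ^ 2 / d := by positivity
  linarith

end Eigenvalues

/-! ### One-dimensional Gaussian integrals of exp(u x²) -/

theorem gaussianPDFReal_smul_exp_mul_sq (u x : ℝ) :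
    gaussianPDFReal 0 1 x • Real.exp (u * x ^ 2) =
      (√(2 * Real.pi))⁻¹ * Real.exp (-(1 / 2 - u) * x ^ 2) := by
  simp only [gaussianPDFReal, NNReal.coe_one, mul_one, sub_zero, smul_eq_mul]
  rw [mul_assoc, ← Real.exp_add]
  ring_nf

theorem integrable_exp_mul_sq_gaussianReal {u : ℝ} (hu : u < 1 / 2) :
    Integrable (fun x : ℝ => Real.exp (u * x ^ 2)) (gaussianReal 0 1) := by
  rw [gaussianReal_of_var_ne_zero _ one_ne_zero,
    integrable_withDensity_iff_integrable_smul' (measurable_gaussianPDF _ _)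
      (ae_of_all _ fun _ => gaussianPDF_lt_top)]
  simp_rw [toReal_gaussianPDF, gaussianPDFReal_smul_exp_mul_sq]
  exact (integrable_exp_neg_mul_sq (by linarith)).const_mul _

theorem integral_exp_mul_sq_gaussianReal {u : ℝ} (hu : u < 1 / 2) :
    ∫ x, Real.exp (u * x ^ 2) ∂gaussianReal 0 1 = (√(1 - 2 * u))⁻¹ := by
  rw [integral_gaussianReal_eq_integral_smul one_ne_zero]
  simp_rw [gaussianPDFReal_smul_exp_mul_sq]
  rw [integral_const_mul, integral_gaussian, ← Real.sqrt_inv, ← Real.sqrt_inv,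
    ← Real.sqrt_mul (by positivity)]
  congr 1
  have : 1 - 2 * u ≠ 0 := by linarith
  have : 1 / 2 - u ≠ 0 := by linarith
  have := Real.pi_ne_zero
  field_simp

/-- For 0 ≤ u ≤ 1/4 one has (1 + 4u)(1 - 2u) ≥ 1, hence 1/(1 - 2u) ≤ exp(4u). -/
theorem integral_exp_mul_sq_gaussianReal_le {u : ℝ} (h0 : 0 ≤ u) (hu : u ≤ 1 / 4) :
    ∫ x, Real.exp (u * x ^ 2) ∂gaussianReal 0 1 ≤ Real.exp (2 * u) := by
  rw [integral_exp_mul_sq_gaussianReal (by linarith)]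
  have h1 : Real.exp (2 * u) = √(Real.exp (4 * u)) := by
    rw [← Real.exp_half]; ring_nf
  rw [h1, ← Real.sqrt_inv]
  refine Real.sqrt_le_sqrt ?_
  refine le_trans ?_ (Real.add_one_le_exp _)
  rw [inv_le_iff_one_le_mul₀ (by linarith)]
  nlinarith

/-- The integral equals 1/√3, and e ≤ 3. -/
theorem integral_exp_neg_sq_gaussianReal_le :
    ∫ x, Real.exp (-1 * x ^ 2) ∂gaussianReal 0 1 ≤ Real.exp (-(1 / 2)) := by
  rw [integral_exp_mul_sq_gaussianReal (by norm_num), Real.exp_neg]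
  gcongr
  refine Real.le_sqrt_of_sq_le ?_
  rw [← Real.exp_nat_mul]
  norm_num
  exact Real.exp_one_lt_three.le

/-! ### Distances to the span of the other vectors, and dual families -/

section OthersSpan

variable {V : Type*} [NormedAddCommGroup V] [InnerProductSpace ℝ V]

/-- The span of a vector `e` and of all members of a family but one. -/
def othersSpan {d : ℕ} (e : V) (k : Fin d) (G : Fin d → V) : Submodule ℝ V :=
  Submodule.span ℝ (insert e (G '' {k}ᶜ))

/-- The vector `e` takes the place of the omitted member, so there are d generators. -/
theorem finrank_othersSpan_le {d : ℕ} (e : V) (k : Fin d) (G : Fin d → V) :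
    Module.finrank ℝ (othersSpan e k G) ≤ d := by
  classical
  have h : (insert e (G '' {k}ᶜ)) =
      ((insert e ((Finset.univ.erase k).image G) : Finset V) : Set V) := by
    ext; simp
  have h1 := finrank_span_finset_le_card (R := ℝ) (insert e ((Finset.univ.erase k).image G))
  rw [othersSpan, h]
  refine h1.trans ((Finset.card_insert_le _ _).trans ?_)
  have := Finset.card_image_le (s := Finset.univ.erase k) (f := G)
  rw [Finset.card_erase_of_mem (Finset.mem_univ k), Finset.card_univ, Fintype.card_fin] at this
  have := k.pos
  omega

theorem mem_othersSpan_iff {d : ℕ} (e : V) (k : Fin d) (G : Fin d → V) (v : V) :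
    v ∈ othersSpan e k G ↔
      ∃ (a : ℝ) (c : Fin d → ℝ), v = a • e + ∑ l ∈ Finset.univ.erase k, c l • G l := by
  classical
  have h : ({k}ᶜ : Set (Fin d)) = ((Finset.univ.erase k : Finset (Fin d)) : Set (Fin d)) := by
    ext; simp
  rw [othersSpan, Submodule.mem_span_insert, h]
  constructor
  · rintro ⟨a, z, hz, rfl⟩
    obtain ⟨c, rfl⟩ := (Submodule.mem_span_image_finset_iff_exists_fun ℝ).1 hz
    refine ⟨a, fun l => if h : l ∈ Finset.univ.erase k then c ⟨l, h⟩ else 0, ?_⟩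
    congr 1
    rw [Finset.univ_eq_attach, ← Finset.sum_attach (Finset.univ.erase k)]
    exact Finset.sum_congr rfl fun l _ => by beta_reduce; rw [dif_pos l.2]
  · rintro ⟨a, c, rfl⟩
    exact ⟨a, _, Submodule.sum_mem _ fun l hl => Submodule.smul_mem _ _
      (Submodule.subset_span ⟨l, hl, rfl⟩), rfl⟩

/-- A union of open conditions over fixed coefficients; it supplies the measurability needed for
Fubini. -/
theorem isOpen_near_othersSpan {d : ℕ} (e : V) (k : Fin d) (t : ℝ) :
    IsOpen {G : Fin d → V | ∃ v ∈ othersSpan e k G, ‖G k - v‖ < t} := by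
  have : {G : Fin d → V | ∃ v ∈ othersSpan e k G, ‖G k - v‖ < t} =
      ⋃ (a : ℝ) (c : Fin d → ℝ),
        {G | ‖G k - (a • e + ∑ l ∈ Finset.univ.erase k, c l • G l)‖ < t} := by
    ext G
    simp only [mem_othersSpan_iff, Set.mem_ofPred_eq, Set.mem_iUnion]
    constructor
    · rintro ⟨_, ⟨a, c, rfl⟩, h⟩; exact ⟨a, c, h⟩
    · rintro ⟨a, c, h⟩; exact ⟨_, ⟨a, c, rfl⟩, h⟩
  rw [this]
  exact isOpen_iUnion fun a => isOpen_iUnion fun c =>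
    isOpen_lt (by fun_prop) continuous_const

/-- If every member of a family is at distance at least `t` from the span of `e` and the others,
then the family has a dual family of vectors of norm at most `1 / t` that are orthogonal to `e`. -/
theorem exists_dual_of_far [FiniteDimensional ℝ V] {d : ℕ} {e : V} {G : Fin d → V} {t : ℝ}
    (ht : 0 < t) (hG : ∀ k, ∀ v ∈ othersSpan e k G, t ≤ ‖G k - v‖) :
    ∃ b : Fin d → V, (∀ k l, inner ℝ (b k) (G l) = if k = l then (1 : ℝ) else 0) ∧
      (∀ k, inner ℝ (b k) e = (0 : ℝ)) ∧ ∀ k, ‖b k‖ ^ 2 ≤ 1 / t ^ 2 := by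
  -- The residual of the projection; p_k/‖p_k‖² is the dual vector because ⟨p_k, G_k⟩ = ‖p_k‖².
  set p : Fin d → V := fun k => G k - (othersSpan e k G).starProjection (G k)
  have hp : ∀ k, t ≤ ‖p k‖ := fun k => hG k _ (Submodule.starProjection_apply_mem _ _)
  have hort : ∀ k, ∀ v ∈ othersSpan e k G, inner ℝ (p k) v = 0 := fun k v hv =>
    Submodule.starProjection_inner_eq_zero _ _ hv
  have hself : ∀ k, inner ℝ (p k) (G k) = ‖p k‖ ^ 2 := fun k => by
    have : G k = p k + (othersSpan e k G).starProjection (G k) := by simp [p]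
    rw [this, inner_add_right, hort k _ (Submodule.starProjection_apply_mem _ _)]
    simp [p]
  refine ⟨fun k => (‖p k‖ ^ 2)⁻¹ • p k, fun k l => ?_, fun k => ?_, fun k => ?_⟩
  · rw [real_inner_smul_left]
    split_ifs with h
    · subst h
      rw [hself, inv_mul_cancel₀]
      have := ht.trans_le (hp k)
      positivity
    · rw [hort k (G l) (Submodule.subset_span (Or.inr ⟨l, fun h' => h h'.symm, rfl⟩)), mul_zero]
  · rw [real_inner_smul_left, hort k e (Submodule.subset_span (Or.inl rfl)), mul_zero]
  · have h1 := ht.trans_le (hp k)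
    rw [norm_smul, norm_inv, norm_pow, norm_norm]
    calc ((‖p k‖ ^ 2)⁻¹ * ‖p k‖) ^ 2 = 1 / ‖p k‖ ^ 2 := by field_simp
      _ ≤ 1 / t ^ 2 := by gcongr; exact hp k

end OthersSpan

/-! ### Small-ball estimates for standard Gaussian vectors -/

section StdGaussian

variable {V W : Type*} [NormedAddCommGroup V] [InnerProductSpace ℝ V] [FiniteDimensional ℝ V]
  [MeasurableSpace V] [BorelSpace V] [NormedAddCommGroup W] [InnerProductSpace ℝ W]
  [FiniteDimensional ℝ W] [MeasurableSpace W] [BorelSpace W]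

/-- Compare characteristic functions; the case used is the orthogonal projection onto a subspace,
whose adjoint is the isometric inclusion. -/
theorem stdGaussian_map_of_norm_adjoint (L : V →L[ℝ] W)
    (hL : ∀ w, ‖ContinuousLinearMap.adjoint L w‖ = ‖w‖) :
    (stdGaussian V).map L = stdGaussian W := by
  have : IsProbabilityMeasure ((stdGaussian V).map L) :=
    Measure.isProbabilityMeasure_map (by fun_prop)
  apply Measure.ext_of_charFun
  ext t
  rw [charFun_stdGaussian, charFun_apply, integral_map (by fun_prop) (by fun_prop)]
  simp_rw [← ContinuousLinearMap.adjoint_inner_right, ← charFun_apply]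
  rw [charFun_stdGaussian, hL]

theorem integral_exp_neg_norm_sq_stdGaussian_le :
    ∫ w, Real.exp (-‖w‖ ^ 2) ∂stdGaussian W ≤
      Real.exp (-(Module.finrank ℝ W / 2)) := by
  rw [stdGaussian, integral_map (Measurable.aemeasurable (by fun_prop))
    (Measurable.aestronglyMeasurable (by fun_prop))]
  have h : ∀ x : Fin (Module.finrank ℝ W) → ℝ,
      Real.exp (-‖∑ i, x i • stdOrthonormalBasis ℝ W i‖ ^ 2) =
        ∏ i, Real.exp (-1 * x i ^ 2) := fun x => by
    rw [← Real.exp_sum, ← (stdOrthonormalBasis ℝ W).sum_sq_inner_right]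
    simp [inner_sum, inner_smul_right, orthonormal_iff_ite.1 (stdOrthonormalBasis ℝ W).orthonormal]
  simp_rw [h]
  rw [integral_fintype_prod_eq_prod (f := fun _ y => Real.exp (-1 * y ^ 2)), Finset.prod_const]
  refine (pow_le_pow_left₀ (integral_nonneg fun _ => (Real.exp_pos _).le)
    integral_exp_neg_sq_gaussianReal_le _).trans_eq ?_
  rw [← Real.exp_nat_mul]
  simp; ring

/-- A standard Gaussian vector is unlikely to be close to a subspace of large codimension. -/
theorem stdGaussian_near_submodule_le (U : Submodule ℝ V) (t : ℝ) :
    stdGaussian V {y | ∃ v ∈ U, ‖y - v‖ < t} ≤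
      ENNReal.ofReal (Real.exp (t ^ 2 - (Module.finrank ℝ V - Module.finrank ℝ U : ℝ) / 2)) := by
  have hfr : (Module.finrank ℝ Uᗮ : ℝ) = Module.finrank ℝ V - Module.finrank ℝ U := by
    rw [← U.finrank_add_finrank_orthogonal]; push_cast; ring
  set p : V →L[ℝ] Uᗮ := Uᗮ.orthogonalProjectionOnto
  have hmap : (stdGaussian V).map p = stdGaussian Uᗮ :=
    stdGaussian_map_of_norm_adjoint p fun w => by
      simp [p, Submodule.adjoint_orthogonalProjectionOnto]
  have hint : ∫ y, Real.exp (-‖p y‖ ^ 2) ∂stdGaussian V ≤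
      Real.exp (-(Module.finrank ℝ Uᗮ / 2)) := by
    refine le_trans (le_of_eq ?_) integral_exp_neg_norm_sq_stdGaussian_le
    rw [← hmap, integral_map (by fun_prop) (by fun_prop)]
  have hsub : {y | ∃ v ∈ U, ‖y - v‖ < t} ⊆ {y | Real.exp (-t ^ 2) ≤ Real.exp (-‖p y‖ ^ 2)} := by
    rintro y ⟨v, hv, hy⟩
    have h1 : p y = p (y - v) := by
      rw [map_sub, show p v = 0 from
        Submodule.orthogonalProjectionOnto_apply_of_mem_orthogonal
          (U.le_orthogonal_orthogonal hv), sub_zero]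
    have h2 : ‖p y‖ ≤ ‖y - v‖ := by
      rw [h1]; exact Uᗮ.norm_orthogonalProjectionOnto_apply_le _
    have h3 : ‖p y‖ ≤ t := h2.trans hy.le
    simp only [Set.mem_ofPred_eq, Real.exp_le_exp, neg_le_neg_iff]
    gcongr
  refine (measure_mono hsub).trans ?_
  rw [← ofReal_measureReal]
  refine ENNReal.ofReal_le_ofReal ?_
  -- Exponential Markov inequality for exp(-‖p y‖²), where p projects onto the orthogonal complement
  -- of U.
  have hmk := mul_meas_ge_le_integral_of_nonneg (μ := stdGaussian V)
    (f := fun y => Real.exp (-‖p y‖ ^ 2)) (ae_of_all _ fun _ => (Real.exp_pos _).le)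
    (Integrable.of_bound (by fun_prop) 1 (ae_of_all _ fun y => by
      rw [Real.norm_of_nonneg (Real.exp_pos _).le]; simp)) (Real.exp (-t ^ 2))
  rw [sub_eq_add_neg, Real.exp_add, ← hfr]
  have h4 := hmk.trans hint
  rwa [mul_comm, ← le_div_iff₀ (Real.exp_pos _), div_eq_mul_inv, ← Real.exp_neg, neg_neg,
    mul_comm] at h4

/-- Freeze all columns except the k-th: the span does not depend on column k, so the estimate for a
fixed subspace applies and is then integrated. -/
theorem pi_stdGaussian_near_othersSpan_le {d : ℕ} (e : V) (k : Fin d) (t : ℝ) :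
    Measure.pi (fun _ : Fin d => stdGaussian V)
        {G | ∃ v ∈ othersSpan e k G, ‖G k - v‖ < t} ≤
      ENNReal.ofReal (Real.exp (t ^ 2 - (Module.finrank ℝ V - d : ℝ) / 2)) := by
  classical
  set B := {G : Fin d → V | ∃ v ∈ othersSpan e k G, ‖G k - v‖ < t}
  have hB : MeasurableSet B := (isOpen_near_othersSpan e k t).measurableSet
  set ε := ENNReal.ofReal (Real.exp (t ^ 2 - (Module.finrank ℝ V - d : ℝ) / 2))
  have key : ∫⁻ G, B.indicator 1 G ∂Measure.pi (fun _ : Fin d => stdGaussian V) ≤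
      ∫⁻ _, ε ∂Measure.pi (fun _ : Fin d => stdGaussian V) := by
    refine lintegral_le_of_lmarginal_le (μ := fun _ : Fin d => stdGaussian V) {k}
      (measurable_one.indicator hB) measurable_const fun G => ?_
    rw [lmarginal_singleton, lmarginal_singleton, lintegral_const, measure_univ, mul_one]
    have hpre : MeasurableSet ((fun y => Function.update G k y) ⁻¹' B) :=
      measurable_update G hB
    have h1 : ∀ y, B.indicator (1 : (Fin d → V) → ENNReal) (Function.update G k y) =
        ((fun y => Function.update G k y) ⁻¹' B).indicator 1 y := fun y => by
      simp [Set.indicator]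
    simp_rw [h1]
    rw [lintegral_indicator_one hpre]
    refine (measure_mono ?_).trans ((stdGaussian_near_submodule_le (othersSpan e k G) t).trans ?_)
    · rintro y ⟨v, hv, hy⟩
      refine ⟨v, ?_, by simpa using hy⟩
      rw [mem_othersSpan_iff] at hv ⊢
      obtain ⟨a, c, rfl⟩ := hv
      refine ⟨a, c, ?_⟩
      congr 1
      refine Finset.sum_congr rfl fun l hl => ?_
      simp only [Function.update_of_ne (Finset.ne_of_mem_erase hl)]
    · refine ENNReal.ofReal_le_ofReal (Real.exp_le_exp.2 ?_)
      have : (Module.finrank ℝ (othersSpan e k G) : ℝ) ≤ d := by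
        exact_mod_cast finrank_othersSpan_le e k G
      linarith
  rwa [lintegral_indicator_one hB, lintegral_const, measure_univ, mul_one] at key

end StdGaussian

/-! ### Spectral decomposition of the covariance, and whitening -/

section Spectral

variable {d : ℕ} {S : Matrix (Fin d) (Fin d) ℝ}

theorem toEuclideanCLM_eigenvectorBasis (hS : S.IsHermitian) (k : Fin d) :
    Matrix.toEuclideanCLM (n := Fin d) (𝕜 := ℝ) S (hS.eigenvectorBasis k) =
      hS.eigenvalues k • hS.eigenvectorBasis k := by
  ext i
  simpa using congrFun (hS.mulVec_eigenvectorBasis k) i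

theorem eigenvalues_le_opNorm (hS : S.IsHermitian) (k : Fin d) :
    hS.eigenvalues k ≤ opNorm S := by
  have h := (Matrix.toEuclideanCLM (n := Fin d) (𝕜 := ℝ) S).le_opNorm (hS.eigenvectorBasis k)
  rw [toEuclideanCLM_eigenvectorBasis, norm_smul, (hS.eigenvectorBasis).norm_eq_one, mul_one,
    mul_one] at h
  exact (le_abs_self _).trans h

theorem trace_inv_eq_sum (hS : S.PosDef) : S⁻¹.trace = ∑ k, (hS.1.eigenvalues k)⁻¹ := by
  have hdet : IsUnit S.det := (Matrix.isUnit_iff_isUnit_det S).1 hS.isUnit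
  have h1 : ∀ k, Matrix.toEuclideanCLM (n := Fin d) (𝕜 := ℝ) S⁻¹ (hS.1.eigenvectorBasis k) =
      (hS.1.eigenvalues k)⁻¹ • hS.1.eigenvectorBasis k := fun k => by
    have h := congrArg (Matrix.toEuclideanCLM (n := Fin d) (𝕜 := ℝ) S⁻¹)
      (toEuclideanCLM_eigenvectorBasis hS.1 k)
    rw [← mul_apply_eq_comp, ← map_mul, Matrix.nonsing_inv_mul _ hdet, map_one,
      map_smul] at h
    rw [eq_inv_smul_iff₀ (hS.eigenvalues_pos k).ne', ← h]
    rfl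
  have h2 : S⁻¹.trace = LinearMap.trace ℝ (EuclideanSpace ℝ (Fin d))
      (Matrix.toEuclideanCLM (n := Fin d) (𝕜 := ℝ) S⁻¹ :
        EuclideanSpace ℝ (Fin d) →ₗ[ℝ] EuclideanSpace ℝ (Fin d)) := by
    rw [LinearMap.trace_eq_sum_inner _ (EuclideanSpace.basisFun (Fin d) ℝ)]
    simp [Matrix.trace, EuclideanSpace.inner_single_left]
  rw [h2, LinearMap.trace_eq_sum_inner _ hS.1.eigenvectorBasis]
  refine Finset.sum_congr rfl fun k _ => ?_
  simp [h1, inner_smul_right]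

/-- The coordinates of `x` in the eigenbasis of `S`, scaled by the inverse square roots of the
eigenvalues. -/
noncomputable def whiten (hS : S.IsHermitian) (x : EuclideanSpace ℝ (Fin d)) :
    EuclideanSpace ℝ (Fin d) :=
  WithLp.toLp 2 fun k => inner ℝ (hS.eigenvectorBasis k) x / √(hS.eigenvalues k)

theorem continuous_whiten (hS : S.IsHermitian) : Continuous (whiten hS) := by
  unfold whiten; fun_prop

theorem inner_eq_sum_whiten (hS : S.PosDef) (x y : EuclideanSpace ℝ (Fin d)) :
    inner ℝ x y = ∑ k, hS.1.eigenvalues k * (whiten hS.1 x k * whiten hS.1 y k) := by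
  rw [← hS.1.eigenvectorBasis.sum_inner_mul_inner x y]
  refine Finset.sum_congr rfl fun k _ => ?_
  have h := (hS.eigenvalues_pos k)
  have h' := Real.sq_sqrt h.le
  have h'' : √(hS.1.eigenvalues k) ≠ 0 := by positivity
  simp only [whiten]
  rw [div_mul_div_comm, ← sq, h', real_inner_comm]
  field_simp

theorem norm_sq_eq_sum_whiten (hS : S.PosDef) (x : EuclideanSpace ℝ (Fin d)) :
    ‖x‖ ^ 2 = ∑ k, hS.1.eigenvalues k * whiten hS.1 x k ^ 2 := by
  rw [← real_inner_self_eq_norm_sq, inner_eq_sum_whiten hS]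
  simp_rw [sq]

/-- Whitening moves t to a vector y with yᵀSy = ‖t‖², so the characteristic functions agree. -/
theorem multivariateGaussian_map_whiten (hS : S.PosDef) :
    (multivariateGaussian 0 S).map (whiten hS.1) = stdGaussian (EuclideanSpace ℝ (Fin d)) := by
  have hm := (continuous_whiten hS.1).measurable
  have : IsProbabilityMeasure ((multivariateGaussian 0 S).map (whiten hS.1)) :=
    Measure.isProbabilityMeasure_map hm.aemeasurable
  apply Measure.ext_of_charFun
  ext t
  rw [charFun_stdGaussian, charFun_apply, integral_map hm.aemeasurable (by fun_prop)]
  set y : EuclideanSpace ℝ (Fin d) :=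
    ∑ k, (t k / √(hS.1.eigenvalues k)) • hS.1.eigenvectorBasis k
  have h1 : ∀ x, inner ℝ (whiten hS.1 x) t = inner ℝ x y := fun x => by
    simp only [y, inner_sum, inner_smul_right]
    rw [PiLp.inner_apply]
    refine Finset.sum_congr rfl fun k _ => ?_
    simp only [whiten, RCLike.inner_apply, conj_trivial, real_inner_comm x]
    ring
  simp_rw [h1, ← charFun_apply]
  rw [charFun_multivariateGaussian hS.posSemidef]
  have h2 : y.ofLp ⬝ᵥ S.mulVec y.ofLp = ‖t‖ ^ 2 := by
    have h3 : y.ofLp ⬝ᵥ S.mulVec y.ofLp =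
        inner ℝ y (Matrix.toEuclideanCLM (n := Fin d) (𝕜 := ℝ) S y) := by
      rw [Matrix.inner_toEuclideanCLM]
    rw [h3]
    simp only [y, map_sum, map_smul, toEuclideanCLM_eigenvectorBasis]
    simp_rw [smul_smul]
    rw [hS.1.eigenvectorBasis.orthonormal.inner_sum, EuclideanSpace.norm_sq_eq]
    refine Finset.sum_congr rfl fun k _ => ?_
    have h := (hS.eigenvalues_pos k)
    have h' := Real.sq_sqrt h.le
    have h'' : √(hS.1.eigenvalues k) ≠ 0 := by positivity
    simp only [conj_trivial, Real.norm_eq_abs, sq_abs]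
    field_simp
    rw [h']
  rw [h2]
  congr 1
  simp
  ring

end Spectral

/-! ### Coefficients of the exponential kernel -/

section Coefficients

variable {d : ℕ} {S : Matrix (Fin d) (Fin d) ℝ}

theorem deriv_expNonlin : deriv expNonlin = fun t => 2 * Real.exp (2 * t) := by
  funext t
  have h : HasDerivAt expNonlin (Real.exp (2 * t) * (2 * 1)) t :=
    (((hasDerivAt_id t).const_mul 2).exp)
  rw [h.deriv]; ring

theorem iteratedDeriv_two_expNonlin : iteratedDeriv 2 expNonlin 0 = 4 := by
  rw [iteratedDeriv_succ, iteratedDeriv_one, deriv_expNonlin]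
  have h : HasDerivAt (fun t : ℝ => 2 * Real.exp (2 * t)) (2 * (Real.exp (2 * 0) * (2 * 1))) 0 :=
    (((hasDerivAt_id (0 : ℝ)).const_mul 2).exp).const_mul 2
  rw [h.deriv]; norm_num

theorem implicitReg_nonneg : 0 ≤ implicitReg expNonlin S := by
  unfold implicitReg coefGamma coefBeta
  rw [deriv_expNonlin]
  have := Real.add_one_le_exp (2 * (S.trace / d))
  simp only [expNonlin, mul_zero, Real.exp_zero]
  refine div_nonneg ?_ (by norm_num)
  linarith

/-- Here α ≥ 1 and β = 2. This lower bound keeps the rescaled dual vector of 1 under control. -/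
theorem half_le_coef_ratio (hS : S.IsHermitian) :
    1 / 2 ≤ coefAlpha expNonlin S / coefBeta expNonlin := by
  unfold coefAlpha coefBeta
  rw [deriv_expNonlin, iteratedDeriv_two_expNonlin]
  have h : 0 ≤ (S * S).trace := by
    have := (Matrix.posSemidef_conjTranspose_mul_self S).trace_nonneg
    rwa [hS.eq] at this
  have : 0 ≤ 4 * ((S * S).trace / (d : ℝ) ^ 2) := by positivity
  simp only [expNonlin, mul_zero, Real.exp_zero]
  linarith

end Coefficients

/-! ### Variance bounds on the good event -/

section Variance

variable {d n : ℕ} {S : Matrix (Fin d) (Fin d) ℝ}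

/-- The all-ones vector. -/
noncomputable def ones (n : ℕ) : EuclideanSpace ℝ (Fin n) := WithLp.toLp 2 fun _ => 1

theorem norm_sq_ones (n : ℕ) : ‖ones n‖ ^ 2 = n := by
  rw [EuclideanSpace.norm_sq_eq]; simp [ones]

/-- The columns of the whitened design matrix. -/
noncomputable def whitenedCol (hS : S.IsHermitian) (X : Fin n → EuclideanSpace ℝ (Fin d)) (k : Fin d) :
    EuclideanSpace ℝ (Fin n) :=
  WithLp.toLp 2 fun i => whiten hS (X i) k

variable {c : ℝ} {X : Fin n → EuclideanSpace ℝ (Fin d)}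

theorem norm_inv_sqrt_smul_sq {V : Type*} [NormedAddCommGroup V] [NormedSpace ℝ V] {a : ℝ}
    (ha : 0 ≤ a) (v : V) : ‖(√a)⁻¹ • v‖ ^ 2 = a⁻¹ * ‖v‖ ^ 2 := by
  rw [norm_smul, mul_pow, norm_inv, inv_pow, Real.norm_eq_abs, sq_abs, Real.sq_sqrt ha]

/-- The squared scalings d/s_k add up to d Tr(S⁻¹); the factor d later cancels the prefactor 1/d of
the variance. -/
theorem sum_norm_scaled_dual_le (hS : S.PosDef) (hd : 0 < d) (hc : 0 < c) (hn : 0 < n)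
    (b : Fin d → EuclideanSpace ℝ (Fin n)) (hb : ∀ k, ‖b k‖ ^ 2 ≤ 1 / (c * n)) :
    ∑ k, ‖(√(hS.1.eigenvalues k / d))⁻¹ • b k‖ ^ 2 ≤ d * (1 / c * (S⁻¹.trace / n)) := by
  rw [trace_inv_eq_sum hS]
  calc _ ≤ ∑ k, (hS.1.eigenvalues k / d)⁻¹ * (1 / (c * n)) := by
        refine Finset.sum_le_sum fun k _ => ?_
        have := hS.eigenvalues_pos k
        rw [norm_inv_sqrt_smul_sq (by positivity)]
        gcongr
        exact hb k
    _ = _ := by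
        rw [← Finset.sum_mul]
        simp_rw [inv_div, div_eq_mul_inv, ← Finset.mul_sum]
        have : (c : ℝ) ≠ 0 := hc.ne'
        have : (n : ℝ) ≠ 0 := by positivity
        field_simp

theorem reducedVariance_le (hS : S.PosDef) (hd : 0 < d) (hn : 0 < n) (hc : 0 < c)
    (hfar : ∀ k, ∀ v ∈ othersSpan (ones n) k (whitenedCol hS.1 X),
      √(c * n) ≤ ‖whitenedCol hS.1 X k - v‖) :
    reducedVariance expNonlin S X ≤ 1 / c * (S⁻¹.trace / n) := by
  have hcn : 0 < c * n := by positivity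
  obtain ⟨b, hb, -, hbn⟩ := exists_dual_of_far (Real.sqrt_pos.2 hcn) hfar
  rw [Real.sq_sqrt hcn.le] at hbn
  have hs : ∀ k, 0 < √(hS.1.eigenvalues k / d) := fun k => by
    have := hS.eigenvalues_pos k
    positivity
  have key := sum_eig_div_le (shiftedGram_isHermitian (1 / (d : ℝ)) 0 X)
    (fun k => √(hS.1.eigenvalues k / d) • whitenedCol hS.1 X k)
    (fun k => (√(hS.1.eigenvalues k / d))⁻¹ • b k) (fun i j => ?_) (fun k l => ?_)
    (implicitReg_nonneg (S := S))
  · unfold reducedVariance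
    rw [one_div_mul_eq_div, div_le_iff₀ (by positivity), mul_comm _ (d : ℝ)]
    exact key.trans (sum_norm_scaled_dual_le hS hd hc hn b hbn)
  · simp only [shiftedGram, designGram, Matrix.add_apply, Matrix.smul_apply, Matrix.of_apply,
      smul_eq_mul, zero_mul, add_zero, PiLp.smul_apply]
    rw [inner_eq_sum_whiten hS, Finset.mul_sum]
    refine Finset.sum_congr rfl fun k _ => ?_
    have := hS.eigenvalues_pos k
    have h := Real.mul_self_sqrt (show 0 ≤ hS.1.eigenvalues k / d by positivity)
    rw [mul_mul_mul_comm, h]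
    simp only [whitenedCol]
    ring
  · rw [real_inner_smul_left, real_inner_smul_right, hb]
    split_ifs with h
    · subst h
      rw [mul_one, inv_mul_cancel₀ (hs k).ne']
    · simp

/-- Take b₀ = (1 - ∑ ⟨1, G_k⟩ b_k)/n: orthogonality of the b_k to 1 gives ⟨b₀, 1⟩ = 1, and duality
cancels ⟨b₀, G_l⟩. Cauchy–Schwarz bounds the norm. -/
theorem exists_dual_ones {b : Fin d → EuclideanSpace ℝ (Fin n)}
    {G : Fin d → EuclideanSpace ℝ (Fin n)} (hd : 0 < d) (hn : 0 < n) (hc : 0 < c) (hc1 : c ≤ 1)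
    (hb : ∀ k l, inner ℝ (b k) (G l) = if k = l then (1 : ℝ) else 0)
    (hb1 : ∀ k, inner ℝ (b k) (ones n) = (0 : ℝ)) (hbn : ∀ k, ‖b k‖ ^ 2 ≤ 1 / (c * n))
    (hG : ∑ k, inner ℝ (ones n) (G k) ^ 2 ≤ (n : ℝ) ^ 2 * d) :
    ∃ b₀ : EuclideanSpace ℝ (Fin n), inner ℝ b₀ (ones n) = (1 : ℝ) ∧
      (∀ k, inner ℝ b₀ (G k) = (0 : ℝ)) ∧ ‖b₀‖ ^ 2 ≤ 4 * d ^ 2 / (c * n) := by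
  have hn' : (0 : ℝ) < n := by exact_mod_cast hn
  have hd' : (1 : ℝ) ≤ d := by exact_mod_cast hd
  set z : Fin d → ℝ := fun k => inner ℝ (ones n) (G k)
  refine ⟨(n : ℝ)⁻¹ • (ones n - ∑ k, z k • b k), ?_, fun l => ?_, ?_⟩
  · rw [real_inner_smul_left, inner_sub_left, sum_inner, real_inner_self_eq_norm_sq, norm_sq_ones]
    simp only [real_inner_smul_left, hb1]
    simp [hn'.ne']
  · rw [real_inner_smul_left, inner_sub_left, sum_inner]
    simp only [real_inner_smul_left, hb]
    simp [z]
  · have h1 : ‖∑ k, z k • b k‖ ^ 2 ≤ n * d ^ 2 / c := by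
      have h2 : ‖∑ k, z k • b k‖ ≤ ∑ k, |z k| * ‖b k‖ :=
        (norm_sum_le _ _).trans_eq (Finset.sum_congr rfl fun k _ => by
          rw [norm_smul, Real.norm_eq_abs])
      calc ‖∑ k, z k • b k‖ ^ 2 ≤ (∑ k, |z k| * ‖b k‖) ^ 2 := by gcongr
        _ ≤ (∑ k, |z k| ^ 2) * ∑ k, ‖b k‖ ^ 2 := Finset.sum_mul_sq_le_sq_mul_sq _ _ _
        _ ≤ ((n : ℝ) ^ 2 * d) * ∑ _k : Fin d, 1 / (c * n) := by
            simp_rw [sq_abs]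
            gcongr with k
            exact hbn k
        _ = n * d ^ 2 / c := by
            rw [Finset.sum_const, Finset.card_univ, Fintype.card_fin, nsmul_eq_mul]
            field_simp
    have h3 : (n : ℝ) ≤ n * d ^ 2 / c := by
      rw [le_div_iff₀ hc]
      have : c ≤ (d : ℝ) ^ 2 := hc1.trans (one_le_pow₀ hd')
      gcongr
    have h4 : ‖ones n - ∑ k, z k • b k‖ ^ 2 ≤ 4 * (n * d ^ 2 / c) := by
      have h5 := norm_sub_le (ones n) (∑ k, z k • b k)
      have h6 := norm_sq_ones n
      have h7 : ‖ones n - ∑ k, z k • b k‖ ^ 2 ≤ (‖ones n‖ + ‖∑ k, z k • b k‖) ^ 2 := by gcongr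
      nlinarith [sq_nonneg (‖ones n‖ - ‖∑ k, z k • b k‖)]
    rw [norm_smul, mul_pow, norm_inv, Real.norm_natCast]
    calc _ ≤ ((n : ℝ)⁻¹) ^ 2 * (4 * (n * d ^ 2 / c)) := by gcongr
      _ = _ := by field_simp

theorem varianceBound_le (hS : S.PosDef) (hS1 : opNorm S ≤ 1) (hd : 0 < d) (hn : 0 < n)
    (hc : 0 < c) (hc1 : c ≤ 1)
    (hfar : ∀ k, ∀ v ∈ othersSpan (ones n) k (whitenedCol hS.1 X),
      √(c * n) ≤ ‖whitenedCol hS.1 X k - v‖)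
    (hsum : ∑ k, inner ℝ (ones n) (whitenedCol hS.1 X k) ^ 2 ≤ (n : ℝ) ^ 2 * d) (σ : ℝ) :
    varianceBound expNonlin σ S X ≤ 72 / c * σ ^ 2 * (S⁻¹.trace / n) := by
  have hcn : 0 < c * n := by positivity
  have hd' : (0 : ℝ) < d := by exact_mod_cast hd
  obtain ⟨b, hb, hb1, hbn⟩ := exists_dual_of_far (Real.sqrt_pos.2 hcn) hfar
  rw [Real.sq_sqrt hcn.le] at hbn
  obtain ⟨b₀, hb₀, hb₀G, hb₀n⟩ := exists_dual_ones hd hn hc hc1 hb hb1 hbn hsum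
  have hs : ∀ k, 0 < √(hS.1.eigenvalues k / d) := fun k => by
    have := hS.eigenvalues_pos k
    positivity
  set a := coefAlpha expNonlin S / coefBeta expNonlin with ha
  have ha2 : 1 / 2 ≤ a := half_le_coef_ratio hS.1
  have ha0 : 0 < a := by linarith
  have hsa : 0 < √a := Real.sqrt_pos.2 ha0
  -- The index `none` carries the generator √a · 1, and `some k` the k-th scaled column.
  have key := sum_eig_div_le (shiftedGram_isHermitian (1 / (d : ℝ)) a X)
    (fun o : Option (Fin d) => o.elim (√a • ones n)
      fun k => √(hS.1.eigenvalues k / d) • whitenedCol hS.1 X k)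
    (fun o => o.elim ((√a)⁻¹ • b₀) fun k => (√(hS.1.eigenvalues k / d))⁻¹ • b k)
    (fun i j => ?_) ?_ (implicitReg_nonneg (S := S))
  · rw [Fintype.sum_option] at key
    simp only [Option.elim_none, Option.elim_some] at key
    have h1 : ‖(√a)⁻¹ • b₀‖ ^ 2 ≤ 8 * d * (d / (c * n)) := by
      rw [norm_inv_sqrt_smul_sq ha0.le]
      calc a⁻¹ * ‖b₀‖ ^ 2 ≤ 2 * (4 * d ^ 2 / (c * n)) := by
            gcongr
            rw [inv_le_iff_one_le_mul₀ ha0]; linarith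
        _ = _ := by ring
    have h2 : (d : ℝ) ≤ S⁻¹.trace := by
      rw [trace_inv_eq_sum hS]
      calc (d : ℝ) = ∑ _k : Fin d, (1 : ℝ) := by simp
        _ ≤ _ := Finset.sum_le_sum fun k _ =>
          (one_le_inv₀ (hS.eigenvalues_pos k)).2 ((eigenvalues_le_opNorm hS.1 k).trans hS1)
    have h3 : (d : ℝ) / (c * n) ≤ 1 / c * (S⁻¹.trace / n) := by
      rw [div_mul_div_comm, one_mul]; gcongr
    have h4 := key.trans (add_le_add (h1.trans (mul_le_mul_of_nonneg_left h3 (by positivity)))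
      (sum_norm_scaled_dual_le hS hd hc hn b hbn))
    have h5 : 0 ≤ opNorm S := norm_nonneg _
    have h6 : 0 ≤ 1 / c * (S⁻¹.trace / n) := le_trans (by positivity) h3
    unfold varianceBound
    -- The direction 1 contributes 8 units and the columns 1, hence 72 = 8 · 9.
    calc _ ≤ 8 * σ ^ 2 * opNorm S / d * (8 * d * (1 / c * (S⁻¹.trace / n)) +
          d * (1 / c * (S⁻¹.trace / n))) := mul_le_mul_of_nonneg_left h4 (by positivity)
      _ = opNorm S * (72 * σ ^ 2 * (1 / c * (S⁻¹.trace / n))) := by field_simp; ring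
      _ ≤ 1 * (72 * σ ^ 2 * (1 / c * (S⁻¹.trace / n))) := by gcongr
      _ = _ := by ring
  · rw [Fintype.sum_option]
    simp only [shiftedGram, designGram, Matrix.add_apply, Matrix.smul_apply, Matrix.of_apply,
      smul_eq_mul, PiLp.smul_apply, Option.elim_none, Option.elim_some]
    rw [inner_eq_sum_whiten hS, Finset.mul_sum, add_comm]
    congr 1
    · simp [ones, Real.mul_self_sqrt ha0.le]
    refine Finset.sum_congr rfl fun k _ => ?_
    have := hS.eigenvalues_pos k
    have h := Real.mul_self_sqrt (show 0 ≤ hS.1.eigenvalues k / d by positivity)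
    rw [mul_mul_mul_comm, h]
    simp only [whitenedCol]
    ring
  · rintro (_ | k) (_ | l)
    · simp [real_inner_smul_left, real_inner_smul_right, hb₀, hsa.ne']
    · simp [real_inner_smul_left, real_inner_smul_right, hb₀G]
    · simp [real_inner_smul_left, real_inner_smul_right, hb1]
    · simp only [Option.elim_some, real_inner_smul_left, real_inner_smul_right, hb,
        Option.some.injEq]
      split_ifs with h
      · subst h
        rw [mul_one]
        exact mul_inv_cancel₀ (hs k).ne'
      · simp

end Variance

/-! ### From independent rows to independent columns -/

section Flip

variable {n d : ℕ}

theorem pi_pi_map_flip (γ : Measure ℝ) [IsProbabilityMeasure γ] :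
    (Measure.pi fun _ : Fin n => Measure.pi fun _ : Fin d => γ).map (fun z k i => z i k) =
      Measure.pi fun _ : Fin d => Measure.pi fun _ : Fin n => γ := by
  simp_rw [← Measure.infinitePi_eq_pi]
  rw [← Measure.infinitePi_map_curry (fun (_ : Fin d) (_ : Fin n) => γ),
    ← Measure.map_infinitePi_infinitePi_of_inj (P := fun _ : Fin n × Fin d => γ)
      (f := fun p : Fin d × Fin n => p.swap) Prod.swap_injective,
    ← Measure.infinitePi_map_curry_symm (fun (_ : Fin n) (_ : Fin d) => γ),
    Measure.map_map (by fun_prop) (by fun_prop), Measure.map_map (by fun_prop) (by fun_prop)]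
  rfl

variable {S : Matrix (Fin d) (Fin d) ℝ}

theorem measurable_whitenedCol (hS : S.IsHermitian) :
    Measurable fun X : Fin n → EuclideanSpace ℝ (Fin d) => whitenedCol hS X := by
  have := (continuous_whiten hS).measurable
  unfold whitenedCol
  fun_prop

theorem multivariateGaussian_map_ofLp_whiten (hS : S.PosDef) :
    (multivariateGaussian 0 S).map (fun x => (whiten hS.1 x).ofLp) =
      Measure.pi fun _ : Fin d => gaussianReal 0 1 := by
  have hm := (continuous_whiten hS.1).measurable
  have h : (fun x => (whiten hS.1 x).ofLp) = WithLp.ofLp ∘ whiten hS.1 := rfl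
  rw [h, ← Measure.map_map (by fun_prop) hm, multivariateGaussian_map_whiten hS,
    ← map_pi_eq_stdGaussian, Measure.map_map (by fun_prop) (by fun_prop)]
  exact Measure.map_id

/-- The whitened columns of a Gaussian design are independent standard Gaussian vectors. -/
theorem pi_multivariateGaussian_map_whitenedCol (hS : S.PosDef) :
    (Measure.pi fun _ : Fin n => multivariateGaussian 0 S).map (whitenedCol hS.1) =
      Measure.pi fun _ : Fin d => stdGaussian (EuclideanSpace ℝ (Fin n)) := by
  have hm : Measurable (fun x => (whiten hS.1 x).ofLp) := by
    have := (continuous_whiten hS.1).measurable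
    fun_prop
  have h : (whitenedCol hS.1 : (Fin n → EuclideanSpace ℝ (Fin d)) → _) =
      (fun (z : Fin d → Fin n → ℝ) k => WithLp.toLp 2 (z k)) ∘ (fun z k i => z i k) ∘
        fun (X : Fin n → EuclideanSpace ℝ (Fin d)) i => (whiten hS.1 (X i)).ofLp := rfl
  have : IsProbabilityMeasure ((multivariateGaussian 0 S).map fun x => (whiten hS.1 x).ofLp) :=
    Measure.isProbabilityMeasure_map hm.aemeasurable
  have : IsProbabilityMeasure ((Measure.pi fun _ : Fin n => gaussianReal 0 1).map (WithLp.toLp 2)) :=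
    Measure.isProbabilityMeasure_map (by fun_prop)
  rw [h, ← Measure.map_map (by fun_prop) (by fun_prop),
    ← Measure.map_map (by fun_prop) (by fun_prop),
    Measure.pi_map_pi fun _ => hm.aemeasurable, multivariateGaussian_map_ofLp_whiten hS,
    pi_pi_map_flip, Measure.pi_map_pi (fun _ => by fun_prop), map_pi_eq_stdGaussian]

end Flip

/-! ### Second moment of exp(2‖x‖²/d) - 1 -/

section ExpMoment

variable {d : ℕ}

theorem integrable_exp_sum_stdGaussian {u : Fin d → ℝ} (hu : ∀ m, u m ≤ 1 / 4) :
    Integrable (fun z : Fin d → ℝ => Real.exp (∑ m, u m * z m ^ 2))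
      (Measure.pi fun _ => gaussianReal 0 1) := by
  simp_rw [Real.exp_sum]
  exact Integrable.fintype_prod (f := fun m x => Real.exp (u m * x ^ 2)) fun m =>
    integrable_exp_mul_sq_gaussianReal ((hu m).trans_lt (by norm_num))

theorem integral_exp_sum_stdGaussian_le {u : Fin d → ℝ} (h0 : ∀ m, 0 ≤ u m)
    (hu : ∀ m, u m ≤ 1 / 4) :
    ∫ z, Real.exp (∑ m, u m * z m ^ 2) ∂(Measure.pi fun _ => gaussianReal 0 1) ≤
      Real.exp (2 * ∑ m, u m) := by
  simp_rw [Real.exp_sum]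
  rw [integral_fintype_prod_eq_prod (f := fun m x => Real.exp (u m * x ^ 2)), Finset.mul_sum,
    Real.exp_sum]
  exact Finset.prod_le_prod (fun m _ => integral_nonneg fun _ => (Real.exp_pos _).le)
    fun m _ => integral_exp_mul_sq_gaussianReal_le (h0 m) (hu m)

theorem exp_two_mul_sub_one_sq_le {q : ℝ} (hq : 0 ≤ q) :
    (Real.exp (2 * q) - 1) ^ 2 ≤ 4 * q ^ 2 * Real.exp (4 * q) := by
  have h1 : Real.exp (2 * q) - 1 ≤ 2 * q * Real.exp (2 * q) := by
    have := Real.add_one_le_exp (-(2 * q))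
    have h2 : Real.exp (-(2 * q)) * Real.exp (2 * q) = 1 := by rw [← Real.exp_add]; simp
    nlinarith [Real.exp_pos (2 * q)]
  have h0 : 0 ≤ Real.exp (2 * q) - 1 := by linarith [Real.add_one_le_exp (2 * q)]
  calc _ ≤ (2 * q * Real.exp (2 * q)) ^ 2 := by gcongr
    _ = 4 * q ^ 2 * Real.exp (4 * q) := by
      rw [mul_pow, ← Real.exp_nat_mul]; push_cast; ring_nf

theorem pow_four_le (x : ℝ) : x ^ 4 ≤ 128 * Real.exp (1 / 8 * x ^ 2) := by
  have := Real.quadratic_le_exp_of_nonneg (show 0 ≤ 1 / 8 * x ^ 2 by positivity)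
  nlinarith [sq_nonneg x]

theorem exp_two_sum_sub_one_sq_le {p z : Fin d → ℝ} (hp : ∀ m, 0 ≤ p m) :
    (Real.exp (2 * ∑ m, p m * z m ^ 2) - 1) ^ 2 ≤
      512 * (∑ m, p m) * ∑ k, p k *
        Real.exp (∑ m, (4 * p m + if m = k then 1 / 8 else 0) * z m ^ 2) := by
  have hq : 0 ≤ ∑ m, p m * z m ^ 2 :=
    Finset.sum_nonneg fun m _ => mul_nonneg (hp m) (sq_nonneg _)
  have hP : 0 ≤ ∑ m, p m := Finset.sum_nonneg fun m _ => hp m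
  have h1 : (∑ m, p m * z m ^ 2) ^ 2 ≤ (∑ m, p m) * ∑ k, p k * z k ^ 4 :=
    Finset.sum_sq_le_sum_mul_sum_of_sq_le_mul _ (fun m _ => hp m)
      (fun m _ => mul_nonneg (hp m) (by positivity)) fun m _ => le_of_eq (by ring)
  have h2 : ∀ k, Real.exp (∑ m, (4 * p m + if m = k then 1 / 8 else 0) * z m ^ 2) =
      Real.exp (4 * ∑ m, p m * z m ^ 2) * Real.exp (1 / 8 * z k ^ 2) := fun k => by
    rw [← Real.exp_add]
    simp_rw [add_mul, Finset.sum_add_distrib, ite_mul, zero_mul, Finset.mul_sum, mul_assoc]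
    simp
  refine (exp_two_mul_sub_one_sq_le hq).trans ?_
  calc 4 * (∑ m, p m * z m ^ 2) ^ 2 * Real.exp (4 * ∑ m, p m * z m ^ 2)
      ≤ 4 * ((∑ m, p m) * ∑ k, p k * (128 * Real.exp (1 / 8 * z k ^ 2))) *
          Real.exp (4 * ∑ m, p m * z m ^ 2) := by
        gcongr
        refine h1.trans ?_
        gcongr with k
        · exact hp k
        · exact pow_four_le _
    _ = _ := by
        simp_rw [h2, mul_left_comm (p _), ← Finset.mul_sum]
        ring

/-- The cap 1/32 keeps every exponent 4p_m + 1/8 within 1/4, and 2(4 + 1/8) ≤ 9 explains exp 9. The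
outer factor ∑ p_m and the weights p_k make the bound quadratic in ∑ p_m. -/
theorem memLp_exp_two_sum_sub_one {p : Fin d → ℝ} (h0 : ∀ m, 0 ≤ p m)
    (hp : ∀ m, p m ≤ 1 / 32) (h1 : ∑ m, p m ≤ 1) :
    MemLp (fun z : Fin d → ℝ => Real.exp (2 * ∑ m, p m * z m ^ 2) - 1) 2
        (Measure.pi fun _ => gaussianReal 0 1) ∧
      ∫ z, (Real.exp (2 * ∑ m, p m * z m ^ 2) - 1) ^ 2 ∂(Measure.pi fun _ => gaussianReal 0 1) ≤
        512 * Real.exp 9 * (∑ m, p m) ^ 2 := by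
  have hP : 0 ≤ ∑ m, p m := Finset.sum_nonneg fun m _ => h0 m
  set u : Fin d → Fin d → ℝ := fun k m => 4 * p m + if m = k then 1 / 8 else 0
  have hu0 : ∀ k m, 0 ≤ u k m := fun k m => by
    have := h0 m
    simp only [u]; split_ifs <;> linarith
  have hu : ∀ k m, u k m ≤ 1 / 4 := fun k m => by
    have := hp m
    simp only [u]; split_ifs <;> linarith
  have hint : Integrable (fun z : Fin d → ℝ => 512 * (∑ m, p m) * ∑ k, p k *
      Real.exp (∑ m, u k m * z m ^ 2)) (Measure.pi fun _ => gaussianReal 0 1) :=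
    (integrable_finsetSum _ fun k _ =>
      (integrable_exp_sum_stdGaussian (hu k)).const_mul _).const_mul _
  have hle := fun z : Fin d → ℝ => exp_two_sum_sub_one_sq_le (z := z) h0
  have hsq : Integrable (fun z : Fin d → ℝ => (Real.exp (2 * ∑ m, p m * z m ^ 2) - 1) ^ 2)
      (Measure.pi fun _ => gaussianReal 0 1) :=
    hint.mono' (Measurable.aestronglyMeasurable (by fun_prop)) (ae_of_all _ fun z => by
      rw [Real.norm_of_nonneg (sq_nonneg _)]; exact hle z)
  refine ⟨(memLp_two_iff_integrable_sq (Measurable.aestronglyMeasurable (by fun_prop))).2 hsq,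
    (integral_mono hsq hint hle).trans ?_⟩
  rw [integral_const_mul, integral_finsetSum _ fun k _ =>
    (integrable_exp_sum_stdGaussian (hu k)).const_mul _]
  simp_rw [integral_const_mul]
  calc _ ≤ 512 * (∑ m, p m) * ∑ k, p k * Real.exp 9 := by
        gcongr with k
        · exact h0 k
        · refine (integral_exp_sum_stdGaussian_le (hu0 k) (hu k)).trans ?_
          gcongr
          simp only [u, Finset.sum_add_distrib, ← Finset.mul_sum]
          simp only [Finset.sum_ite_eq', Finset.mem_univ, if_true]
          linarith
    _ = _ := by rw [← Finset.sum_mul]; ring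

end ExpMoment

/-! ### Chebyshev bound for averages over rows -/

section RowSum

/-- Chebyshev's inequality for an average of independent copies of a function with second moment
at most `K τ²`. -/
theorem pi_measure_average_gt_le {E : Type*} [MeasurableSpace E] {ν : Measure E}
    [IsProbabilityMeasure ν] {ψ : E → ℝ} {n : ℕ} {K τ : ℝ} (hn : 0 < n) (hK : 1 ≤ K) (hτ : 0 < τ)
    (hψ : MemLp ψ 2 ν) (hsq : ∫ x, ψ x ^ 2 ∂ν ≤ K * τ ^ 2) :
    Measure.pi (fun _ : Fin n => ν) {X | ¬ 1 / (n : ℝ) * ∑ i, ψ (X i) ≤ (K + 1) * τ} ≤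
      ENNReal.ofReal (K / n) := by
  have hn' : (0 : ℝ) < n := by exact_mod_cast hn
  have hvar : Var[ψ; ν] = ∫ x, ψ x ^ 2 ∂ν - (∫ x, ψ x ∂ν) ^ 2 := variance_eq_sub hψ
  have hvle : Var[ψ; ν] ≤ K * τ ^ 2 := by nlinarith [sq_nonneg (∫ x, ψ x ∂ν)]
  have hmean : ∫ x, ψ x ∂ν ≤ K * τ := by
    refine le_of_abs_le (abs_le_of_sq_le_sq ?_ (by positivity))
    have := variance_nonneg ψ ν
    nlinarith [mul_nonneg (sub_nonneg.2 hK) (mul_nonneg (by linarith : 0 ≤ K) (sq_nonneg τ))]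
  have hmem : ∀ i, MemLp (fun X : Fin n → E => ψ (X i)) 2 (Measure.pi fun _ : Fin n => ν) :=
    fun i => hψ.comp_measurePreserving (measurePreserving_eval _ i)
  have hint : ∫ X, ∑ i, ψ (X i) ∂(Measure.pi fun _ : Fin n => ν) = n * ∫ x, ψ x ∂ν := by
    rw [integral_finsetSum _ fun i _ => (hmem i).integrable one_le_two]
    have : ∀ i, ∫ X, ψ (X i) ∂(Measure.pi fun _ : Fin n => ν) = ∫ x, ψ x ∂ν := fun i =>
      integral_comp_eval hψ.aestronglyMeasurable
    simp [this]
  have hsumvar : Var[fun X => ∑ i, ψ (X i); Measure.pi fun _ : Fin n => ν] = n * Var[ψ; ν] := by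
    have := variance_sum_pi (μ := fun _ : Fin n => ν) (X := fun _ => ψ) fun _ => hψ
    simp only [Finset.sum_const, Finset.card_univ, Fintype.card_fin, nsmul_eq_mul] at this
    rw [← this]; congr 1; ext X; simp
  have hch := meas_ge_le_variance_div_sq (c := n * τ)
    (memLp_finsetSum (f := fun i (X : Fin n → E) => ψ (X i)) Finset.univ fun i _ => hmem i)
    (by positivity)
  refine (measure_mono ?_).trans (hch.trans (ENNReal.ofReal_le_ofReal ?_))
  -- The mean is at most Kτ, so exceeding (K + 1)τ is a deviation of at least τ.
  · intro X hX
    simp only [Set.mem_ofPred_eq, not_le] at hX ⊢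
    rw [hint]
    refine le_trans ?_ (le_abs_self _)
    rw [one_div_mul_eq_div, lt_div_iff₀ hn'] at hX
    nlinarith
  · rw [hsumvar]
    calc n * Var[ψ; ν] / (n * τ) ^ 2 ≤ n * (K * τ ^ 2) / (n * τ) ^ 2 := by gcongr
      _ = K / n := by field_simp

end RowSum

/-! ### Probabilities of the three exceptional events -/

section Events

variable {d n : ℕ} {S : Matrix (Fin d) (Fin d) ℝ}

theorem trace_div_eq_sum (hS : S.IsHermitian) :
    S.trace / d = ∑ k, hS.eigenvalues k / d := by
  rw [hS.trace_eq_sum_eigenvalues, Finset.sum_div]; simp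

theorem trace_div_pos (hS : S.PosDef) (hd : 0 < d) : 0 < S.trace / d := by
  have : Nonempty (Fin d) := ⟨⟨0, hd⟩⟩
  exact div_pos hS.trace_pos (by exact_mod_cast hd)

theorem pi_multivariateGaussian_average_le (hS : S.PosDef) (hS1 : opNorm S ≤ 1) (hd : 32 ≤ d)
    (hn : 0 < n) :
    Measure.pi (fun _ : Fin n => multivariateGaussian 0 S)
        {X | ¬ 1 / (n : ℝ) * ∑ i, (Real.exp (2 * (‖X i‖ ^ 2 / d)) - 1) ≤
          (512 * Real.exp 9 + 1) * (S.trace / d)} ≤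
      ENNReal.ofReal (512 * Real.exp 9 / n) := by
  have hd' : (32 : ℝ) ≤ d := by exact_mod_cast hd
  set p : Fin d → ℝ := fun k => hS.1.eigenvalues k / d
  have hs1 : ∀ k, hS.1.eigenvalues k ≤ 1 := fun k => (eigenvalues_le_opNorm hS.1 k).trans hS1
  have h0 : ∀ k, 0 ≤ p k := fun k => div_nonneg (hS.eigenvalues_pos k).le (by positivity)
  have hp : ∀ k, p k ≤ 1 / 32 := fun k =>
    div_le_div₀ zero_le_one (hs1 k) (by norm_num) hd'
  have h1 : ∑ k, p k ≤ 1 := by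
    calc ∑ k, p k ≤ ∑ _k : Fin d, 1 / (d : ℝ) := by
          gcongr with k
          exact div_le_div_of_nonneg_right (hs1 k) (by positivity)
      _ = 1 := by
          rw [Finset.sum_const, Finset.card_univ, Fintype.card_fin, nsmul_eq_mul]
          field_simp
  obtain ⟨hmem, hint⟩ := memLp_exp_two_sum_sub_one h0 hp h1
  have hψ : ∀ x : EuclideanSpace ℝ (Fin d), Real.exp (2 * (‖x‖ ^ 2 / d)) - 1 =
      Real.exp (2 * ∑ m, p m * (whiten hS.1 x).ofLp m ^ 2) - 1 := fun x => by
    rw [norm_sq_eq_sum_whiten hS, Finset.sum_div]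
    simp only [p, div_mul_eq_mul_div]
  have hm : Measurable (fun x => (whiten hS.1 x).ofLp) := by
    have := (continuous_whiten hS.1).measurable
    fun_prop
  rw [← multivariateGaussian_map_ofLp_whiten hS] at hmem hint
  have hmem' := hmem.comp_of_map hm.aemeasurable
  rw [integral_map hm.aemeasurable (Measurable.aestronglyMeasurable (by fun_prop))] at hint
  refine pi_measure_average_gt_le (ψ := fun x : EuclideanSpace ℝ (Fin d) =>
    Real.exp (2 * (‖x‖ ^ 2 / d)) - 1) hn ?_ (trace_div_pos hS (by omega)) ?_ ?_
  · have := Real.add_one_le_exp (9 : ℝ)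
    linarith
  · simp_rw [hψ]; exact hmem'
  · simp_rw [hψ, trace_div_eq_sum hS.1]; exact hint

/-- The expectation is dn, so Markov's inequality at the generous threshold n²d costs exactly 1/n.
-/
theorem pi_stdGaussian_sum_inner_sq_le (hd : 0 < d) (hn : 0 < n) :
    Measure.pi (fun _ : Fin d => stdGaussian (EuclideanSpace ℝ (Fin n)))
        {G | ¬ ∑ k, inner ℝ (ones n) (G k) ^ 2 ≤ (n : ℝ) ^ 2 * d} ≤
      ENNReal.ofReal (1 / n) := by
  have hn' : (0 : ℝ) < n := by exact_mod_cast hn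
  have hd' : (0 : ℝ) < d := by exact_mod_cast hd
  set V := EuclideanSpace ℝ (Fin n)
  set f : V → ℝ := fun v => inner ℝ (ones n) v ^ 2
  have hLp : MemLp (innerSL ℝ (ones n)) 2 (stdGaussian V) := IsGaussian.memLp_dual _ _ _ (by simp)
  have hfi : Integrable f (stdGaussian V) := hLp.integrable_sq
  have hf : ∫ v, f v ∂stdGaussian V = n := by
    have h1 := variance_dual_stdGaussian (innerSL ℝ (ones n))
    rw [variance_of_integral_eq_zero (by fun_prop) (integral_strongDual_stdGaussian _),
      innerSL_apply_norm, norm_sq_ones] at h1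
    exact h1
  have hmem : ∀ k, Integrable (fun G : Fin d → V => f (G k))
      (Measure.pi fun _ : Fin d => stdGaussian V) := fun k => integrable_comp_eval hfi
  have hint : ∫ G, ∑ k, f (G k) ∂(Measure.pi fun _ : Fin d => stdGaussian V) = d * n := by
    rw [integral_finsetSum _ fun k _ => hmem k]
    have : ∀ k, ∫ G, f (G k) ∂(Measure.pi fun _ : Fin d => stdGaussian V) = n := fun k => by
      rw [integral_comp_eval hfi.aestronglyMeasurable, hf]
    simp [this]
  have hmk := mul_meas_ge_le_integral_of_nonneg
    (μ := Measure.pi fun _ : Fin d => stdGaussian V) (f := fun G => ∑ k, f (G k))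
    (ae_of_all _ fun G => Finset.sum_nonneg fun k _ => sq_nonneg _)
    (integrable_finsetSum _ fun k _ => hmem k) ((n : ℝ) ^ 2 * d)
  rw [hint] at hmk
  refine (measure_mono (t := {G | (n : ℝ) ^ 2 * d ≤ ∑ k, f (G k)}) ?_).trans ?_
  · intro G hG
    exact (not_le.1 hG).le
  · rw [← ofReal_measureReal]
    refine ENNReal.ofReal_le_ofReal ?_
    rw [le_div_iff₀ hn']
    have h2 : 0 < (d : ℝ) * n := by positivity
    refine le_of_mul_le_mul_left ?_ h2
    calc _ = (n : ℝ) ^ 2 * d * (Measure.pi fun _ : Fin d => stdGaussian V).real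
          {G | (n : ℝ) ^ 2 * d ≤ ∑ k, f (G k)} := by ring
      _ ≤ d * n := hmk
      _ = _ := by ring

/-- With y = (1-ρ)n/4 the codimension bound gives exponent y - (n-d)/2 ≤ -y. The union over d ≤ n
columns is paid for by exp(-y) ≤ 2/y². -/
theorem pi_stdGaussian_exists_near_le {ρ : ℝ} (hρ : ρ < 1) (hn : 0 < n)
    (hdn : (d : ℝ) ≤ ρ * n) :
    Measure.pi (fun _ : Fin d => stdGaussian (EuclideanSpace ℝ (Fin n)))
        (⋃ k, {G | ∃ v ∈ othersSpan (ones n) k G, ‖G k - v‖ < √((1 - ρ) / 4 * n)}) ≤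
      ENNReal.ofReal (32 / (1 - ρ) ^ 2 / n) := by
  have hn' : (0 : ℝ) < n := by exact_mod_cast hn
  have hρ' : 0 < 1 - ρ := by linarith
  set y := (1 - ρ) / 4 * n with hy
  have hy0 : 0 < y := by positivity
  have hd : (d : ℝ) ≤ n := by nlinarith
  have hk : ∀ k : Fin d, Measure.pi (fun _ : Fin d => stdGaussian (EuclideanSpace ℝ (Fin n)))
      {G | ∃ v ∈ othersSpan (ones n) k G, ‖G k - v‖ < √y} ≤ ENNReal.ofReal (Real.exp (-y)) :=
    fun k => by
      refine (pi_stdGaussian_near_othersSpan_le (ones n) k (√y)).trans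
        (ENNReal.ofReal_le_ofReal (Real.exp_le_exp.2 ?_))
      rw [Real.sq_sqrt hy0.le, finrank_euclideanSpace_fin]
      linarith
  refine (measure_iUnion_fintype_le _ _).trans ((Finset.sum_le_sum fun k _ => hk k).trans ?_)
  rw [Finset.sum_const, Finset.card_univ, Fintype.card_fin, ← ENNReal.ofReal_nsmul]
  refine ENNReal.ofReal_le_ofReal ?_
  rw [nsmul_eq_mul]
  have hq := Real.quadratic_le_exp_of_nonneg hy0.le
  have hexp : Real.exp (-y) ≤ 2 / y ^ 2 := by
    rw [Real.exp_neg, inv_le_comm₀ (Real.exp_pos _) (by positivity), inv_div]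
    linarith
  calc (d : ℝ) * Real.exp (-y) ≤ n * (2 / y ^ 2) := by gcongr
    _ = _ := by rw [hy]; field_simp; norm_num

end Events

end Ridgeless

/-! ### Assembly of the main theorem -/

theorem mainTheorem4 :
    ∃ d₀ : ℕ, ∀ ρ : ℝ, 0 < ρ → ρ < 1 → ∃ C : ℝ, 0 < C ∧
      ∀ d n : ℕ, d₀ ≤ d → (d : ℝ) ≤ ρ * n →
      ∀ S : Matrix (Fin d) (Fin d) ℝ, S.PosDef → Ridgeless.opNorm S ≤ 1 →
      ∀ (Ω : Type*) [MeasurableSpace Ω] (P : Measure Ω) [IsProbabilityMeasure P]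
        (X : Fin n → Ω → EuclideanSpace ℝ (Fin d)),
        (∀ i, HasLaw (X i) (multivariateGaussian 0 S) P) → iIndepFun X P →
      ∀ (H : Type*) [NormedAddCommGroup H] [InnerProductSpace ℝ H] [CompleteSpace H]
        [RKHS ℝ H (EuclideanSpace ℝ (Fin d)) ℝ],
        (∀ x x' : EuclideanSpace ℝ (Fin d),
          RKHS.kernel H x x' 1 = Ridgeless.innerKernel Ridgeless.expNonlin x x') →
      ∀ (f : H) (σ : ℝ), 0 < σ →
        P {ω | ¬ (
          Ridgeless.varianceBound Ridgeless.expNonlin σ S (fun i => X i ω)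
              ≤ C * σ ^ 2 * (S⁻¹.trace / n) ∧
          (∀ M : ℝ, 0 ≤ M →
            Ridgeless.biasBound Ridgeless.expNonlin ‖f‖ M (fun i => X i ω)
              ≤ ‖f‖ ^ 2 * (C * (Ridgeless.implicitReg Ridgeless.expNonlin S + S.trace / d)
                  + 2 * M / √n)) ∧
          Ridgeless.reducedVariance Ridgeless.expNonlin S (fun i => X i ω)
              ≤ C * (S⁻¹.trace / n) ∧
          Ridgeless.reducedBias Ridgeless.expNonlin S (fun i => X i ω)
              ≤ C * (Ridgeless.implicitReg Ridgeless.expNonlin S + S.trace / d))}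
          ≤ ENNReal.ofReal (C / n) := by
  -- For d ≥ 32 and ‖Σ‖ ≤ 1 the weights s_k/d stay below the cap 1/32 of the exponential moment
  -- bound.
  refine ⟨32, fun ρ hρ0 hρ1 => ?_⟩
  have hρ : 0 < 1 - ρ := by linarith
  -- The terms 512e⁹, 1 and 32/(1-ρ)² cover the three exceptional probabilities; 288/(1-ρ) is 72/c
  -- with c = (1-ρ)/4.
  refine ⟨512 * Real.exp 9 + 2 + 288 / (1 - ρ) + 32 / (1 - ρ) ^ 2, by positivity, ?_⟩
  set C := 512 * Real.exp 9 + 2 + 288 / (1 - ρ) + 32 / (1 - ρ) ^ 2 with hC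
  intro d n hd hdn S hS hS1 Ω _ P _ X hX hind H _ _ _ _ _ f σ _
  have hd0 : 0 < d := by omega
  have hd' : (0 : ℝ) < d := by exact_mod_cast hd0
  have hn' : (0 : ℝ) < n := by
    by_contra! h
    nlinarith
  have hn : 0 < n := by exact_mod_cast hn'
  have hA : 512 * Real.exp 9 + 1 ≤ C := by
    have : 0 ≤ 288 / (1 - ρ) + 32 / (1 - ρ) ^ 2 := by positivity
    linarith
  have hD : 288 / (1 - ρ) ≤ C := by
    have : 0 ≤ 512 * Real.exp 9 + 2 + 32 / (1 - ρ) ^ 2 := by positivity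
    linarith
  have hC0 : 0 ≤ C := le_trans (by positivity) hA
  have htr : 0 ≤ S⁻¹.trace / n := div_nonneg hS.inv.posSemidef.trace_nonneg hn'.le
  have hτ : 0 < S.trace / d := Ridgeless.trace_div_pos hS hd0
  have hr : 0 ≤ Ridgeless.implicitReg Ridgeless.expNonlin S := Ridgeless.implicitReg_nonneg
  set μ := Measure.pi fun _ : Fin n => multivariateGaussian (0 : EuclideanSpace ℝ (Fin d)) S
  have hlaw : P.map (fun ω i => X i ω) = μ := by
    rw [hind.map_fun_eq_pi_map fun i => (hX i).aemeasurable]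
    simp_rw [(hX _).map_eq]
    rfl
  have hmeas : AEMeasurable (fun ω i => X i ω) P :=
    aemeasurable_pi_iff.2 fun i => (hX i).aemeasurable
  set T : (Fin n → EuclideanSpace ℝ (Fin d)) → Fin d → EuclideanSpace ℝ (Fin n) :=
    Ridgeless.whitenedCol hS.1
  have hT : Measurable T := Ridgeless.measurable_whitenedCol hS.1
  have hTle : ∀ B, μ (T ⁻¹' B) ≤
      Measure.pi (fun _ : Fin d => stdGaussian (EuclideanSpace ℝ (Fin n))) B := fun B => by
    rw [← Ridgeless.pi_multivariateGaussian_map_whitenedCol hS]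
    exact Measure.le_map_apply hT.aemeasurable B
  set B₁ : Set (Fin n → EuclideanSpace ℝ (Fin d)) :=
    {x | ¬ 1 / (n : ℝ) * ∑ i, (Real.exp (2 * (‖x i‖ ^ 2 / d)) - 1) ≤
      (512 * Real.exp 9 + 1) * (S.trace / d)}
  set B₂ : Set (Fin d → EuclideanSpace ℝ (Fin n)) :=
    {G | ¬ ∑ k, inner ℝ (Ridgeless.ones n) (G k) ^ 2 ≤ (n : ℝ) ^ 2 * d}
  set B₃ : Set (Fin d → EuclideanSpace ℝ (Fin n)) :=
    ⋃ k, {G | ∃ v ∈ Ridgeless.othersSpan (Ridgeless.ones n) k G,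
      ‖G k - v‖ < √((1 - ρ) / 4 * n)}
  have hbad : μ (B₁ ∪ T ⁻¹' B₂ ∪ T ⁻¹' B₃) ≤ ENNReal.ofReal (C / n) := by
    refine (measure_union_le _ _).trans ((add_le_add (measure_union_le _ _) le_rfl).trans ?_)
    refine (add_le_add (add_le_add (Ridgeless.pi_multivariateGaussian_average_le hS hS1 hd hn)
      ((hTle B₂).trans (Ridgeless.pi_stdGaussian_sum_inner_sq_le hd0 hn)))
      ((hTle B₃).trans (Ridgeless.pi_stdGaussian_exists_near_le hρ1 hn hdn))).trans ?_
    rw [← ENNReal.ofReal_add (by positivity) (by positivity),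
      ← ENNReal.ofReal_add (by positivity) (by positivity), ← add_div, ← add_div]
    refine ENNReal.ofReal_le_ofReal (div_le_div_of_nonneg_right ?_ hn'.le)
    have : 0 ≤ 288 / (1 - ρ) := by positivity
    linarith
  refine le_trans (measure_mono (t := (fun ω i => X i ω) ⁻¹' (B₁ ∪ T ⁻¹' B₂ ∪ T ⁻¹' B₃)) ?_)
    ((Measure.le_map_apply hmeas _).trans (hlaw ▸ hbad))
  intro ω hω
  by_contra hgood
  refine hω ?_
  set x := fun i => X i ω
  simp only [Set.mem_preimage, Set.mem_union, not_or] at hgood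
  obtain ⟨⟨h1, h2⟩, h3⟩ := hgood
  replace h1 := not_not.1 h1
  replace h2 := not_not.1 h2
  have hfar : ∀ k, ∀ v ∈ Ridgeless.othersSpan (Ridgeless.ones n) k (T x),
      √((1 - ρ) / 4 * n) ≤ ‖T x k - v‖ := fun k v hv => by
    by_contra! h
    exact h3 (Set.mem_iUnion.2 ⟨k, v, hv, h⟩)
  have hc : 0 < (1 - ρ) / 4 := by positivity
  have h1' : 1 / (n : ℝ) * ∑ i, (Real.exp (2 * (‖x i‖ ^ 2 / d)) - 1) ≤ C * (S.trace / d) :=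
    h1.trans (by gcongr)
  refine ⟨?_, fun M _ => ?_, ?_, ?_⟩
  · refine (Ridgeless.varianceBound_le hS hS1 hd0 hn hc (by linarith) hfar h2 σ).trans ?_
    have : 72 / ((1 - ρ) / 4) = 288 / (1 - ρ) := by field_simp; norm_num
    rw [this]
    gcongr
  · refine (Ridgeless.biasBound_le hn x ‖f‖ M).trans ?_
    refine mul_le_mul_of_nonneg_left (add_le_add (h1'.trans ?_) le_rfl) (sq_nonneg _)
    exact mul_le_mul_of_nonneg_left (le_add_of_nonneg_left hr) hC0
  · refine (Ridgeless.reducedVariance_le hS hd0 hn hc hfar).trans ?_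
    refine mul_le_mul_of_nonneg_right (le_trans ?_ hD) htr
    rw [one_div_div]
    gcongr
    norm_num
  · refine (Ridgeless.reducedBias_le S x).trans ?_
    rw [mul_add]
    refine add_le_add (le_mul_of_one_le_left hr (le_trans ?_ hA)) h1'
    have := Real.exp_pos 9
    linarith
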